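/- Let $\mu$ be a Borel measure on $\mathbb R$ with $\mu(\mathbb R)=\infty$ and $\int_{\mathbb R}\frac{d\mu(\lambda)}{1+\lambda^2}=1$, and let $\varkappa\in\mathbb C$, $|\varkappa|<1$. In $L^2(\mathbb R;d\mu)$ let $\mathcal B$ be the self-adjoint operator of multiplication by $\lambda$ on $\mathrm{Dom}(\mathcal B)=\{f:\int\lambda^2|f(\lambda)|^2d\mu(\lambda)<\infty\}$, let $\dot{\mathcal B}$ be its restriction to $\{f\in\mathrm{Dom}(\mathcal B):\int f\,d\mu=0\}$, and let $\widehat{\mathcal B}$ be the restriction of $(\dot{\mathcal B})^*$ to $\mathrm{Dom}(\dot{\mathcal B})\dot+\mathrm{span}\{\frac1{\lambda-i}-\varkappa\frac1{\lambda+i}\}$; $\mathfrak B=(\dot{\mathcal B},\widehat{\mathcal B},\mathcal B)$ is the model triple. Definitions. A triple $\mathfrak A=(\dot A,\widehat A,A)$ is regular if $\dot A$ is a densely defined symmetric operator with deficiency indices $(1,1)$, $\widehat A\neq\widehat A^*$ is a maximal dissipative extension of $\dot A$ and $A$ is a self-adjoint extension of $\dot A$. An extension $\widehat A$ of $\dot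 A$ is quasi-self-adjoint if $\dot A\subset\widehat A\subset(\dot A)^*$ and $\dot A=\widehat A|_{\mathrm{Dom}(\widehat A)\cap\mathrm{Dom}(\widehat A^*)}$. Choose $g_\pm\in\mathrm{Ker}((\dot A)^*\mp iI)$ with $\|g_\pm\|=1$ and $g_+-g_-\in\mathrm{Dom}(A)$. For $z\in\mathbb C_+$ the Weyl–Titchmarsh and Livšic functions of $(\dot A,A)$ are $$M_{(\dot A,A)}(z)=\big((zA+I)(A-zI)^{-1}g_+,g_+\big),\qquad s_{(\dot A,A)}(z)=\frac{z-i}{z+i}\cdot\frac{(g_z,g_-)}{(g_z,g_+)},\quad 0\ne g_z\in\mathrm{Ker}((\dot A)^*-zI);$$ the von Neumann parameter of $\mathfrak A$ is the number $k$, $|k|<1$, with $g_+-kg_-\in\mathrm{Dom}(\widehat A)$; and the characteristic function of $\mathfrak A$ is $S_{\mathfrak A}(z)=\frac{s(z)-k}{\overline k\,s(z)-1}$ with $s=s_{(\dot A,A)}$. These do not depend on the choices made. Theorem. Assume that $0$ belongs to the core of the spectrum of $\dot{\mathcal B}$, in the sense that $$\int_{\mathbb R}\frac{d\mu(\lambda)}{\lambda^2}=\infty\quad\text{and}\quad\mu(\{0\})=0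 .$$ Then $\dot{\mathcal B}$, $\widehat{\mathcal B}$, $\mathcal B$ are injective and (i) $(\dot{\mathcal B})^{-1}$ is a densely defined symmetric operator with deficiency indices $(1,1)$; (ii) $\mathcal B^{-1}$ is a self-adjoint extension of $(\dot{\mathcal B})^{-1}$; (iii) $(\widehat{\mathcal B})^{-1}$ is a quasi-self-adjoint extension of $(\dot{\mathcal B})^{-1}$. In particular the triple $\mathfrak C=(-(\dot{\mathcal B})^{-1},-(\widehat{\mathcal B})^{-1},-\mathcal B^{-1})$ is well defined and regular. Moreover, (iv) the von Neumann parameters of $\mathfrak B$ and $\mathfrak C$ coincide (both equal $\varkappa$); and the Livšic, Weyl–Titchmarsh and characteristic functions below are well defined and satisfy, for all $z\in\mathbb C_+$, (v) $s_{(-(\dot{\mathcal B})^{-1},-\mathcal B^{-1})}(-1/z)=s_{(\dot{\mathcal B},\mathcal B)}(z)$; (vi) $M_{(-(\dot{\mathcal B})^{-1},-\mathcal B^{-1})}(-1/z)=M_{(\dot{\mathcal B},\mathcal B)}(z)$; (vii) $S_{\mathfrak C}(-1/z)=S_{\mathfrak B}(z)$. -/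

import Mathlib

open MeasureTheory
open scoped ENNReal

noncomputable section

namespace TripleModel

section Abstract

variable {H : Type*} [NormedAddCommGroup H] [InnerProductSpace ℂ H]

/-- Densely defined symmetric operator. -/
def IsSymmetricOp (T : H →ₗ.[ℂ] H) : Prop :=
  Dense (T.domain : Set H) ∧ T.IsFormalAdjoint T

/-- `Im (T f, f) ≥ 0` on the domain (the form `(f, g)` linear in `f` is `inner ℂ g f`). -/
def IsDissipative (T : H →ₗ.[ℂ] H) : Prop :=
  ∀ f : T.domain, 0 ≤ (inner ℂ (f : H) (T f)).im

/-- Dissipative, without proper dissipative extensions. -/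
def IsMaximalDissipative (T : H →ₗ.[ℂ] H) : Prop :=
  IsDissipative T ∧ ∀ S : H →ₗ.[ℂ] H, IsDissipative S → T ≤ S → S = T

variable [CompleteSpace H]

/-- The defect subspace `Ker (T* - z I)`. -/
def defectSpace (T : H →ₗ.[ℂ] H) (z : ℂ) : Submodule ℂ H where
  carrier := {g | ∃ h : g ∈ T.adjoint.domain, T.adjoint ⟨g, h⟩ = z • g}
  zero_mem' := ⟨T.adjoint.domain.zero_mem, by
    rw [smul_zero]; exact T.adjoint.map_zero⟩
  add_mem' := by
    rintro a b ⟨ha, ea⟩ ⟨hb, eb⟩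
    refine ⟨T.adjoint.domain.add_mem ha hb, ?_⟩
    have := T.adjoint.map_add ⟨a, ha⟩ ⟨b, hb⟩
    rw [ea, eb] at this
    rw [smul_add]
    exact this
  smul_mem' := by
    rintro c a ⟨ha, ea⟩
    refine ⟨T.adjoint.domain.smul_mem c ha, ?_⟩
    have := T.adjoint.map_smul c ⟨a, ha⟩
    rw [ea] at this
    rw [smul_comm]
    exact this

/-- `dim Ker (T* - iI) = m` and `dim Ker (T* + iI) = n`. -/
def HasDeficiencyIndices (T : H →ₗ.[ℂ] H) (m n : Cardinal) : Prop :=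
  Module.rank ℂ (defectSpace T Complex.I) = m ∧ Module.rank ℂ (defectSpace T (-Complex.I)) = n

/-- `A` is a self-adjoint extension of `A₀`. -/
def IsSelfAdjointExtension (A₀ A : H →ₗ.[ℂ] H) : Prop :=
  A₀ ≤ A ∧ IsSelfAdjoint A

/-- `A₀ ⊂ Â ⊂ A₀*` and `A₀` is the restriction of `Â` to `Dom Â ∩ Dom Â*`. -/
def IsQuasiSelfAdjointExtension (A₀ Ahat : H →ₗ.[ℂ] H) : Prop :=
  A₀ ≤ Ahat ∧ Ahat ≤ A₀.adjoint ∧ Ahat.domRestrict Ahat.adjoint.domain = A₀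

/-- Normalized deficiency elements `g₊ ∈ Ker (A₀* - iI)`, `g₋ ∈ Ker (A₀* + iI)` such that
`g₊ - g₋ ∈ Dom A`. -/
structure IsDeficiencyPair (A₀ A : H →ₗ.[ℂ] H) (gp gm : H) : Prop where
  mem_plus : gp ∈ defectSpace A₀ Complex.I
  mem_minus : gm ∈ defectSpace A₀ (-Complex.I)
  norm_plus : ‖gp‖ = 1
  norm_minus : ‖gm‖ = 1
  sub_mem : gp - gm ∈ A.domain

/-- `s` is, on the upper half-plane, the Livšic function of the pair `(A₀, A)`:
`s z = (z - i) / (z + i) * (g_z, g₋) / (g_z, g₊)` for `0 ≠ g_z ∈ Ker (A₀* - zI)`.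
All the choices that enter exist, the denominators do not vanish, and the value is the same
for every choice; hence `s` is determined on the upper half-plane. -/
structure IsLivsicFunction (A₀ A : H →ₗ.[ℂ] H) (s : ℂ → ℂ) : Prop where
  exists_pair : ∃ gp gm, IsDeficiencyPair A₀ A gp gm
  exists_defect : ∀ z : ℂ, 0 < z.im → ∃ g ∈ defectSpace A₀ z, g ≠ 0
  formula : ∀ gp gm, IsDeficiencyPair A₀ A gp gm → ∀ z : ℂ, 0 < z.im →
    ∀ g ∈ defectSpace A₀ z, g ≠ 0 →
      inner ℂ gp g ≠ 0 ∧
      s z = (z - Complex.I) / (z + Complex.I) * (inner ℂ gm g / inner ℂ gp g)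

/-- `M` is, on the upper half-plane, the Weyl–Titchmarsh function of the pair `(A₀, A)`:
`M z = ((z A + I) (A - z I)⁻¹ g₊, g₊)`. Here `f = (A - z I)⁻¹ g₊`; the choices exist and the value
does not depend on them. -/
structure IsWeylTitchmarshFunction (A₀ A : H →ₗ.[ℂ] H) (M : ℂ → ℂ) : Prop where
  exists_pair : ∃ gp gm, IsDeficiencyPair A₀ A gp gm
  bijective : ∀ z : ℂ, 0 < z.im → Function.Bijective fun f : A.domain => A f - z • (f : H)
  formula : ∀ gp gm, IsDeficiencyPair A₀ A gp gm → ∀ z : ℂ, 0 < z.im →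
    ∀ f : A.domain, A f - z • (f : H) = gp → M z = inner ℂ gp (z • A f + (f : H))

/-- Three operators in one Hilbert space. -/
structure OperatorTriple (H : Type*) [NormedAddCommGroup H] [InnerProductSpace ℂ H] where
  /-- the symmetric operator -/
  symm : H →ₗ.[ℂ] H
  /-- its dissipative extension -/
  diss : H →ₗ.[ℂ] H
  /-- its reference self-adjoint extension -/
  ref : H →ₗ.[ℂ] H

/-- Regular triples: a densely defined symmetric operator with deficiency indices `(1, 1)`,
a maximal dissipative, non-self-adjoint extension of it, and a self-adjoint extension of it. -/
structure OperatorTriple.IsRegular (𝔄 : OperatorTriple H) : Prop where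
  symmetric : IsSymmetricOp 𝔄.symm
  indices : HasDeficiencyIndices 𝔄.symm 1 1
  le_diss : 𝔄.symm ≤ 𝔄.diss
  maximalDissipative : IsMaximalDissipative 𝔄.diss
  not_selfAdjoint : ¬ IsSelfAdjoint 𝔄.diss
  selfAdjointExtension : IsSelfAdjointExtension 𝔄.symm 𝔄.ref

/-- `k` is the von Neumann parameter of the triple: `|k| < 1` and `g₊ - k g₋ ∈ Dom Â`
(admissible pairs `g₊, g₋` exist, and the membership holds for each of them). -/
structure OperatorTriple.IsVonNeumannParameter (𝔄 : OperatorTriple H) (k : ℂ) : Prop where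
  norm_lt_one : ‖k‖ < 1
  exists_pair : ∃ gp gm, IsDeficiencyPair 𝔄.symm 𝔄.ref gp gm
  mem_domain : ∀ gp gm, IsDeficiencyPair 𝔄.symm 𝔄.ref gp gm → gp - k • gm ∈ 𝔄.diss.domain

/-- `S` is, on the upper half-plane, the characteristic function of the triple:
`S z = (s z - k) / (conj k * s z - 1)` with the Livšic function `s` of `(Ȧ, A)` and the
von Neumann parameter `k`. -/
def OperatorTriple.IsCharacteristicFunction (𝔄 : OperatorTriple H) (S : ℂ → ℂ) : Prop :=
  ∃ (s : ℂ → ℂ) (k : ℂ), IsLivsicFunction 𝔄.symm 𝔄.ref s ∧ 𝔄.IsVonNeumannParameter k ∧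
    ∀ z : ℂ, 0 < z.im → starRingEnd ℂ k * s z - 1 ≠ 0 ∧
      S z = (s z - k) / (starRingEnd ℂ k * s z - 1)

/-- The triple `(-Ȧ⁻¹, -Â⁻¹, -A⁻¹)`; meaningful if the three operators are injective. -/
def OperatorTriple.negInverse (𝔄 : OperatorTriple H) : OperatorTriple H where
  symm := -𝔄.symm.inverse
  diss := -𝔄.diss.inverse
  ref := -𝔄.ref.inverse

end Abstract

section Model

/-- The self-adjoint operator of multiplication by the independent variable in `L²(ℝ; dμ)`, on
`{f | ∫ t² |f t|² dμ(t) < ∞}`. -/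
def mulOp (μ : Measure ℝ) : Lp ℂ 2 μ →ₗ.[ℂ] Lp ℂ 2 μ where
  domain :=
    { carrier := {f | MemLp (fun t : ℝ => (t : ℂ) * f t) 2 μ}
      zero_mem' := by
        refine (memLp_congr_ae ?_).mpr (MemLp.zero (p := 2) (μ := μ) (ε := ℂ))
        filter_upwards [Lp.coeFn_zero ℂ 2 μ] with t ht
        simp only [ht, Pi.zero_apply, mul_zero]
      add_mem' := by
        intro f g hf hg
        refine (memLp_congr_ae ?_).mpr (MemLp.add hf hg)
        filter_upwards [Lp.coeFn_add f g] with t ht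
        simp only [ht, Pi.add_apply, mul_add]
      smul_mem' := by
        intro c f hf
        refine (memLp_congr_ae ?_).mpr (MemLp.const_smul hf c)
        filter_upwards [Lp.coeFn_smul c f] with t ht
        simp [ht, mul_left_comm] }
  toFun :=
    { toFun := fun f => MemLp.toLp (fun t : ℝ => (t : ℂ) * (f : Lp ℂ 2 μ) t) f.2
      map_add' := by
        rintro ⟨f, hf⟩ ⟨g, hg⟩
        rw [← MemLp.toLp_add]
        refine MemLp.toLp_congr _ _ ?_
        filter_upwards [Lp.coeFn_add f g] with t ht
        change (t : ℂ) * (f + g : Lp ℂ 2 μ) t = (t : ℂ) * f t + (t : ℂ) * g t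
        rw [ht, Pi.add_apply, mul_add]
      map_smul' := by
        rintro c ⟨f, hf⟩
        rw [RingHom.id_apply, ← MemLp.toLp_const_smul]
        refine MemLp.toLp_congr _ _ ?_
        filter_upwards [Lp.coeFn_smul c f] with t ht
        simp [ht, mul_left_comm] }

/-- The elements of `L²(ℝ; dμ)` with `∫ f dμ = 0`. (If `∫ dμ(t) / (1 + t²) < ∞`, every `f` in the
domain of the multiplication operator is integrable.) -/
def zeroMean (μ : Measure ℝ) : Submodule ℂ (Lp ℂ 2 μ) where
  carrier := {f | Integrable f μ ∧ ∫ t, f t ∂μ = 0}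
  zero_mem' := by
    have h := Lp.coeFn_zero ℂ 2 μ
    refine ⟨(integrable_congr h).mpr (integrable_zero _ _ _), ?_⟩
    rw [integral_congr_ae h]
    simp
  add_mem' := by
    rintro f g ⟨hf, ef⟩ ⟨hg, eg⟩
    have h := Lp.coeFn_add f g
    refine ⟨(integrable_congr h).mpr (hf.add hg), ?_⟩
    rw [integral_congr_ae h]
    simp [integral_add hf hg, ef, eg]
  smul_mem' := by
    rintro c f ⟨hf, ef⟩
    have h := Lp.coeFn_smul c f
    refine ⟨(integrable_congr h).mpr (hf.smul c), ?_⟩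
    rw [integral_congr_ae h]
    simp [integral_const_mul, ef]

/-- The symmetric restriction of the multiplication operator to `{f ∈ Dom | ∫ f dμ = 0}`. -/
def symmOp (μ : Measure ℝ) : Lp ℂ 2 μ →ₗ.[ℂ] Lp ℂ 2 μ :=
  (mulOp μ).domRestrict (zeroMean μ)

/-- The line spanned by the class of `1 / (t - i) - κ / (t + i)`. -/
def extensionLine (μ : Measure ℝ) (κ : ℂ) : Submodule ℂ (Lp ℂ 2 μ) :=
  Submodule.span ℂ {f | (f : ℝ → ℂ) =ᵐ[μ]
    fun t => 1 / ((t : ℂ) - Complex.I) - κ * (1 / ((t : ℂ) + Complex.I))}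

/-- The quasi-self-adjoint extension of `symmOp μ`: the restriction of `(symmOp μ)*` to
`Dom (symmOp μ) + span {1 / (t - i) - κ / (t + i)}`. -/
def dissOp (μ : Measure ℝ) (κ : ℂ) : Lp ℂ 2 μ →ₗ.[ℂ] Lp ℂ 2 μ :=
  (symmOp μ).adjoint.domRestrict ((symmOp μ).domain ⊔ extensionLine μ κ)

/-- The model triple in `L²(ℝ; dμ)`. -/
def modelTriple (μ : Measure ℝ) (κ : ℂ) : OperatorTriple (Lp ℂ 2 μ) where
  symm := symmOp μ
  diss := dissOp μ κ
  ref := mulOp μ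

/-- The core of the spectrum of the model symmetric operator:
the real `s` with `∫ dμ(t) / (t - s)² = ∞` and `μ {s} = 0`. -/
def coreSpectrum (μ : Measure ℝ) : Set ℝ :=
  {s | ∫⁻ t, ENNReal.ofReal (1 / (t - s) ^ 2) ∂μ = ∞ ∧ μ {s} = 0}

end Model

end TripleModel

end

open TripleModel

/-!
When `Ȧ*` is injective, the defect space of `-Ȧ⁻¹` at `z` is the defect space of `Ȧ` at `-1 / z`.
The points `±i` are fixed by `z ↦ -1 / z`, and `(g₊, g₋)` is a deficiency pair for
`(Ȧ, A)` exactly when `(g₊, -g₋)` is one for `(-Ȧ⁻¹, -A⁻¹)`. Hence passing to negative inverses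
keeps the von Neumann parameter and composes the Livšic, Weyl–Titchmarsh and characteristic
functions with `z ↦ -1 / z`. The Livšic function of a pair exists because it is the Cayley transform
of its Weyl–Titchmarsh function.

In the model, the defect space at `z` is spanned by the Cauchy kernel `1 / (t - z)`, and `(u, v)`
belongs to the graph of the adjoint of the symmetric operator only if `v(t) = t u(t) - c` for some
constant `c`. An element of the kernel of the adjoint therefore satisfies `t u(t) = c`; as
`∫ dμ(t) / t² = ∞` and `μ {0} = 0`, square integrability forces `c = 0` and then `u = 0`.
-/

namespace TripleModel

open Complex (I)
open scoped ComplexConjugate InnerProductSpace LinearPMap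

section Graph

variable {R E F : Type*} [Ring R] [AddCommGroup E] [Module R E] [AddCommGroup F] [Module R F]
  {S T : E →ₗ.[R] F}

lemma mem_graph_neg {x : E} {y : F} : (x, y) ∈ (-T).graph ↔ (x, -y) ∈ T.graph := by
  simp only [LinearPMap.mem_graph_iff]
  constructor
  · rintro ⟨u, rfl, hu⟩
    exact ⟨u, rfl, by rw [← hu, LinearPMap.neg_apply, neg_neg]⟩
  · rintro ⟨u, rfl, hu⟩
    exact ⟨u, rfl, by rw [LinearPMap.neg_apply, hu, neg_neg]⟩

lemma mem_graph_domRestrict {p : Submodule R E} {x : E} {y : F} :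
    (x, y) ∈ (T.domRestrict p).graph ↔ x ∈ p ∧ (x, y) ∈ T.graph := by
  simp only [LinearPMap.mem_graph_iff]
  constructor
  · rintro ⟨u, rfl, hu⟩
    exact ⟨u.2.1, ⟨u, u.2.2⟩, rfl, by rw [← hu]; exact (LinearPMap.domRestrict_apply rfl).symm⟩
  · rintro ⟨hx, u, rfl, hu⟩
    exact ⟨⟨u, hx, u.2⟩, rfl, by rw [← hu]; exact LinearPMap.domRestrict_apply rfl⟩

lemma ker_eq_bot_iff : LinearMap.ker T.toFun = ⊥ ↔ ∀ x, (x, (0 : F)) ∈ T.graph → x = 0 := by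
  rw [LinearMap.ker_eq_bot']
  constructor
  · intro h x hx
    obtain ⟨u, rfl, hu⟩ := (LinearPMap.mem_graph_iff _).1 hx
    exact congrArg Subtype.val (h u hu)
  · intro h u hu
    exact Subtype.ext (h u ((LinearPMap.mem_graph_iff _).2 ⟨u, rfl, hu⟩))

lemma mem_graph_fst_inj (hT : LinearMap.ker T.toFun = ⊥) {x₁ x₂ : E} {y : F}
    (h₁ : (x₁, y) ∈ T.graph) (h₂ : (x₂, y) ∈ T.graph) : x₁ = x₂ := by
  have h := T.graph.sub_mem h₁ h₂
  rw [Prod.mk_sub_mk, sub_self] at h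
  exact sub_eq_zero.1 (ker_eq_bot_iff.1 hT _ h)

lemma ker_eq_bot_of_le (h : S ≤ T) (hT : LinearMap.ker T.toFun = ⊥) :
    LinearMap.ker S.toFun = ⊥ :=
  ker_eq_bot_iff.2 fun x hx => ker_eq_bot_iff.1 hT x (LinearPMap.le_graph_of_le h hx)

lemma neg_mono (h : S ≤ T) : -S ≤ -T :=
  LinearPMap.le_of_le_graph fun _ hxy =>
    mem_graph_neg.2 (LinearPMap.le_graph_of_le h (mem_graph_neg.1 hxy))

lemma mem_graph_inverse (hT : LinearMap.ker T.toFun = ⊥) {x : F} {y : E} :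
    (x, y) ∈ T.inverse.graph ↔ (y, x) ∈ T.graph := by
  rw [LinearPMap.inverse_graph hT, Submodule.mem_map]
  constructor
  · rintro ⟨⟨a, b⟩, hab, h⟩
    obtain ⟨rfl, rfl⟩ := Prod.mk.inj h
    exact hab
  · exact fun h => ⟨(y, x), h, rfl⟩

lemma mem_graph_neg_inverse (hT : LinearMap.ker T.toFun = ⊥) {x : F} {y : E} :
    (x, y) ∈ (-T.inverse).graph ↔ (-y, x) ∈ T.graph := by
  rw [mem_graph_neg, mem_graph_inverse hT]

lemma inverse_mono (h : S ≤ T) (hT : LinearMap.ker T.toFun = ⊥) : S.inverse ≤ T.inverse := by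
  refine LinearPMap.le_of_le_graph ?_
  rintro ⟨x, y⟩ hxy
  rw [mem_graph_inverse (ker_eq_bot_of_le h hT)] at hxy
  exact (mem_graph_inverse hT).2 (LinearPMap.le_graph_of_le h hxy)

lemma ker_neg_inverse (hT : LinearMap.ker T.toFun = ⊥) :
    LinearMap.ker (-T.inverse).toFun = ⊥ :=
  ker_eq_bot_iff.2 fun _ hx =>
    LinearPMap.graph_fst_eq_zero_snd _ ((mem_graph_neg_inverse hT).1 hx) neg_zero

lemma neg_inverse_neg_inverse (hT : LinearMap.ker T.toFun = ⊥) :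
    -(-T.inverse).inverse = T := by
  refine LinearPMap.eq_of_eq_graph (Submodule.ext ?_)
  rintro ⟨x, y⟩
  rw [mem_graph_neg_inverse (ker_neg_inverse hT), mem_graph_neg_inverse hT,
    ← Submodule.neg_mem_iff, Prod.neg_mk, neg_neg, neg_neg]

lemma mem_inverse_domain_iff (h : S ≤ T) (hT : LinearMap.ker T.toFun = ⊥) {x : E} {y : F}
    (hxy : (x, y) ∈ T.graph) : y ∈ S.inverse.domain ↔ x ∈ S.domain := by
  have hS := ker_eq_bot_of_le h hT
  simp only [LinearPMap.mem_domain_iff, mem_graph_inverse hS]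
  constructor
  · rintro ⟨x', hx'⟩
    obtain rfl := mem_graph_fst_inj hT hxy (LinearPMap.le_graph_of_le h hx')
    exact ⟨y, hx'⟩
  · rintro ⟨y', hy'⟩
    obtain rfl := LinearPMap.mem_graph_snd_inj _ hxy (LinearPMap.le_graph_of_le h hy') rfl
    exact ⟨x, hy'⟩

end Graph

section Adjoint

variable {𝕜 E F : Type*} [RCLike 𝕜] [NormedAddCommGroup E] [InnerProductSpace 𝕜 E]
  [NormedAddCommGroup F] [InnerProductSpace 𝕜 F] {T : E →ₗ.[𝕜] F}

lemma isFormalAdjoint_iff {S : F →ₗ.[𝕜] E} :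
    S.IsFormalAdjoint T ↔ ∀ a b c d, (a, b) ∈ S.graph → (c, d) ∈ T.graph →
      ⟪b, c⟫_𝕜 = ⟪a, d⟫_𝕜 := by
  constructor
  · intro h a b c d hab hcd
    obtain ⟨u, rfl, rfl⟩ := (LinearPMap.mem_graph_iff _).1 hab
    obtain ⟨v, rfl, rfl⟩ := (LinearPMap.mem_graph_iff _).1 hcd
    exact h u v
  · exact fun h u v => h _ _ _ _ (S.mem_graph u) (T.mem_graph v)

variable [CompleteSpace E]

lemma mem_graph_adjoint (hT : Dense (T.domain : Set E)) {x : F} {y : E} :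
    (x, y) ∈ T†.graph ↔ ∀ a b, (a, b) ∈ T.graph → ⟪b, x⟫_𝕜 = ⟪a, y⟫_𝕜 := by
  rw [LinearPMap.adjoint_graph_eq_graph_adjoint hT, Submodule.mem_adjoint_iff]
  simp only [sub_eq_zero]

lemma adjoint_anti {S : E →ₗ.[𝕜] F} (hS : Dense (S.domain : Set E)) (h : S ≤ T) : T† ≤ S† := by
  refine LinearPMap.le_of_le_graph ?_
  rintro ⟨x, y⟩ hxy
  rw [mem_graph_adjoint (hS.mono h.1)] at hxy
  exact (mem_graph_adjoint hS).2 fun a b hab => hxy a b (LinearPMap.le_graph_of_le h hab)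

lemma adjoint_neg (hT : Dense (T.domain : Set E)) : (-T)† = -T† := by
  refine LinearPMap.eq_of_eq_graph (Submodule.ext ?_)
  rintro ⟨x, y⟩
  rw [mem_graph_neg, mem_graph_adjoint (T := -T) hT, mem_graph_adjoint hT]
  constructor
  · intro h a b hab
    have hab' := h a (-b) (mem_graph_neg.2 (by rwa [neg_neg]))
    rwa [inner_neg_left, neg_eq_iff_eq_neg, ← inner_neg_right] at hab'
  · intro h a b hab
    have hab' := h a (-b) (mem_graph_neg.1 hab)
    rwa [inner_neg_left, inner_neg_right, neg_inj] at hab'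

lemma dense_inverse_domain [CompleteSpace F] (hT : Dense (T.domain : Set E))
    (hker : LinearMap.ker T.toFun = ⊥) (hadj : LinearMap.ker T†.toFun = ⊥) :
    Dense (T.inverse.domain : Set F) := by
  rw [Submodule.dense_iff_topologicalClosure_eq_top,
    Submodule.topologicalClosure_eq_top_iff, Submodule.eq_bot_iff]
  intro x hx
  refine ker_eq_bot_iff.1 hadj x ((mem_graph_adjoint hT).2 fun a b hab => ?_)
  rw [inner_zero_right]
  exact hx b (LinearPMap.mem_domain_of_mem_graph ((mem_graph_inverse hker).2 hab))

lemma adjoint_inverse [CompleteSpace F] (hT : Dense (T.domain : Set E))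
    (hker : LinearMap.ker T.toFun = ⊥) (hadj : LinearMap.ker T†.toFun = ⊥) :
    T.inverse† = T†.inverse := by
  refine LinearPMap.eq_of_eq_graph (Submodule.ext ?_)
  rintro ⟨x, y⟩
  rw [mem_graph_inverse hadj, mem_graph_adjoint (dense_inverse_domain hT hker hadj),
    mem_graph_adjoint hT]
  constructor
  · exact fun h a b hab => (h b a ((mem_graph_inverse hker).2 hab)).symm
  · exact fun h a b hab => (h b a ((mem_graph_inverse hker).1 hab)).symm

variable {A : E →ₗ.[𝕜] E}

lemma isSelfAdjoint_neg (hA : IsSelfAdjoint A) : IsSelfAdjoint (-A) := by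
  rw [LinearPMap.isSelfAdjoint_def, adjoint_neg hA.dense_domain, LinearPMap.isSelfAdjoint_def.1 hA]

lemma isSelfAdjoint_inverse (hA : IsSelfAdjoint A) (hker : LinearMap.ker A.toFun = ⊥) :
    IsSelfAdjoint A.inverse := by
  have hadj := LinearPMap.isSelfAdjoint_def.1 hA
  rw [LinearPMap.isSelfAdjoint_def, adjoint_inverse hA.dense_domain hker (by rwa [hadj]), hadj]

lemma isSelfAdjoint_neg_inverse_iff (hker : LinearMap.ker A.toFun = ⊥) :
    IsSelfAdjoint (-A.inverse) ↔ IsSelfAdjoint A := by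
  refine ⟨fun h => ?_, fun h => isSelfAdjoint_neg (isSelfAdjoint_inverse h hker)⟩
  rw [← neg_inverse_neg_inverse hker]
  exact isSelfAdjoint_neg (isSelfAdjoint_inverse h (ker_neg_inverse hker))

end Adjoint

section SymmetricInverse

variable {H : Type*} [NormedAddCommGroup H] [InnerProductSpace ℂ H] {T : H →ₗ.[ℂ] H}

lemma IsSymmetricOp.neg (hT : IsSymmetricOp T) : IsSymmetricOp (-T) := by
  refine ⟨hT.1, fun x y => ?_⟩
  rw [LinearPMap.neg_apply, LinearPMap.neg_apply, inner_neg_left, inner_neg_right,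
    neg_inj]
  exact hT.2 x y

variable [CompleteSpace H]

lemma IsSymmetricOp.inverse (hT : IsSymmetricOp T) (hadj : LinearMap.ker T†.toFun = ⊥) :
    IsSymmetricOp T.inverse := by
  have hker := ker_eq_bot_of_le (hT.2.le_adjoint hT.1) hadj
  refine ⟨dense_inverse_domain hT.1 hker hadj, isFormalAdjoint_iff.2 fun a b c d hab hcd => ?_⟩
  rw [mem_graph_inverse hker] at hab hcd
  exact (isFormalAdjoint_iff.1 hT.2 _ _ _ _ hab hcd).symm

lemma mem_defectSpace {z : ℂ} {g : H} : g ∈ defectSpace T z ↔ (g, z • g) ∈ T†.graph := by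
  rw [LinearPMap.mem_graph_iff]
  constructor
  · rintro ⟨hg, heq⟩
    exact ⟨⟨g, hg⟩, rfl, heq⟩
  · rintro ⟨⟨u, hu⟩, rfl, heq⟩
    exact ⟨hu, heq⟩

lemma defectSpace_neg (hT : Dense (T.domain : Set H)) (z : ℂ) :
    defectSpace (-T) z = defectSpace T (-z) := by
  ext g
  rw [mem_defectSpace, mem_defectSpace, adjoint_neg hT, mem_graph_neg, neg_smul]

lemma defectSpace_inverse (hT : Dense (T.domain : Set H)) (hker : LinearMap.ker T.toFun = ⊥)
    (hadj : LinearMap.ker T†.toFun = ⊥) {z : ℂ} (hz : z ≠ 0) :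
    defectSpace T.inverse z = defectSpace T z⁻¹ := by
  ext g
  rw [mem_defectSpace, mem_defectSpace, adjoint_inverse hT hker hadj, mem_graph_inverse hadj,
    ← T†.graph.smul_mem_iff (inv_ne_zero hz), Prod.smul_mk, inv_smul_smul₀ hz]

lemma defectSpace_neg_inverse (hT : Dense (T.domain : Set H)) (hker : LinearMap.ker T.toFun = ⊥)
    (hadj : LinearMap.ker T†.toFun = ⊥) {z : ℂ} (hz : z ≠ 0) :
    defectSpace (-T.inverse) z = defectSpace T (-1 / z) := by
  rw [defectSpace_neg (dense_inverse_domain hT hker hadj),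
    defectSpace_inverse hT hker hadj (neg_ne_zero.2 hz), inv_neg, neg_div, one_div]

lemma HasDeficiencyIndices.neg {m n : Cardinal} (h : HasDeficiencyIndices T m n)
    (hT : Dense (T.domain : Set H)) : HasDeficiencyIndices (-T) n m := by
  rw [HasDeficiencyIndices, defectSpace_neg hT, defectSpace_neg hT, neg_neg]
  exact h.symm

lemma HasDeficiencyIndices.inverse {m n : Cardinal} (h : HasDeficiencyIndices T m n)
    (hT : Dense (T.domain : Set H)) (hker : LinearMap.ker T.toFun = ⊥)
    (hadj : LinearMap.ker T†.toFun = ⊥) : HasDeficiencyIndices T.inverse n m := by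
  rw [HasDeficiencyIndices, defectSpace_inverse hT hker hadj Complex.I_ne_zero,
    defectSpace_inverse hT hker hadj (neg_ne_zero.2 Complex.I_ne_zero), inv_neg, Complex.inv_I,
    neg_neg]
  exact h.symm

lemma IsQuasiSelfAdjointExtension.inverse {A₀ X : H →ₗ.[ℂ] H}
    (h : IsQuasiSelfAdjointExtension A₀ X) (hA₀ : Dense (A₀.domain : Set H))
    (hadj : LinearMap.ker A₀†.toFun = ⊥) :
    IsQuasiSelfAdjointExtension A₀.inverse X.inverse := by
  obtain ⟨hle, hleAdj, hrestrict⟩ := h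
  have hX : Dense (X.domain : Set H) := hA₀.mono hle.1
  have hXadj := adjoint_anti hA₀ hle
  have hkerX := ker_eq_bot_of_le hleAdj hadj
  have kA₀ := ker_eq_bot_of_le hle hkerX
  refine ⟨inverse_mono hle hkerX, ?_, LinearPMap.eq_of_eq_graph (Submodule.ext ?_)⟩
  · rw [adjoint_inverse hA₀ kA₀ hadj]
    exact inverse_mono hleAdj hadj
  · rintro ⟨x, y⟩
    rw [adjoint_inverse hX hkerX (ker_eq_bot_of_le hXadj hadj), mem_graph_domRestrict,
      mem_graph_inverse hkerX, mem_graph_inverse kA₀, ← hrestrict, mem_graph_domRestrict]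
    exact and_congr_left fun hyx =>
      mem_inverse_domain_iff hXadj hadj (LinearPMap.le_graph_of_le hleAdj hyx)

end SymmetricInverse

section Dissipative

variable {H : Type*} [NormedAddCommGroup H] [InnerProductSpace ℂ H] {S T : H →ₗ.[ℂ] H}

lemma im_inner_self (x : H) : (⟪x, x⟫_ℂ).im = 0 := inner_self_im (𝕜 := ℂ) x

lemma re_inner_self (x : H) : (⟪x, x⟫_ℂ).re = ‖x‖ ^ 2 := inner_self_eq_norm_sq (𝕜 := ℂ) x

lemma im_inner_sub_smul_add (x y : H) :
    (⟪x - y, I • (x + y)⟫_ℂ).im = ‖x‖ ^ 2 - ‖y‖ ^ 2 := by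
  have hre : (⟪y, x⟫_ℂ).re = (⟪x, y⟫_ℂ).re := inner_re_symm (𝕜 := ℂ) y x
  rw [inner_smul_right, Complex.I_mul_im, inner_sub_left, inner_add_right, inner_add_right]
  simp only [Complex.sub_re, Complex.add_re, re_inner_self, hre]
  ring

lemma im_inner_eq_zero_of_isFormalAdjoint (hT : T.IsFormalAdjoint T) {x y : H}
    (hxy : (x, y) ∈ T.graph) : (⟪x, y⟫_ℂ).im = 0 := by
  have h := isFormalAdjoint_iff.1 hT _ _ _ _ hxy hxy
  rw [← inner_conj_symm] at h
  exact Complex.conj_eq_iff_im.1 h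

lemma isDissipative_iff : IsDissipative T ↔ ∀ x y, (x, y) ∈ T.graph → 0 ≤ (⟪x, y⟫_ℂ).im := by
  constructor
  · intro h x y hxy
    obtain ⟨u, rfl, rfl⟩ := (LinearPMap.mem_graph_iff _).1 hxy
    exact h u
  · exact fun h u => h _ _ (T.mem_graph u)

/- The form `Im ⟪x, T x⟫` is positive semidefinite, so a vector on which it vanishes lies in its
radical. -/
lemma IsDissipative.inner_eq_of_im_eq_zero (hT : IsDissipative T) {x x' y y' : H}
    (hx : (x, x') ∈ T.graph) (hy : (y, y') ∈ T.graph) (h0 : (⟪x, x'⟫_ℂ).im = 0) :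
    ⟪x', y⟫_ℂ = ⟪x, y'⟫_ℂ := by
  set d : ℂ := ⟪x, y'⟫_ℂ - ⟪x', y⟫_ℂ with hd
  have hform : ∀ t : ℝ, 0 ≤ (⟪y, y'⟫_ℂ).im - t * ‖d‖ ^ 2 := by
    intro t
    have hpos := isDissipative_iff.1 hT _ _
      (T.graph.add_mem (T.graph.smul_mem (t * I * d) hx) hy)
    have hexpand : (⟪(t * I * d) • x + y, (t * I * d) • x' + y'⟫_ℂ).im =
        (⟪y, y'⟫_ℂ).im - t * ‖d‖ ^ 2 := by
      have hsymm : ⟪y, x'⟫_ℂ = conj ⟪x', y⟫_ℂ := (inner_conj_symm _ _).symm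
      simp only [inner_add_left, inner_add_right, inner_smul_left, inner_smul_right, hsymm]
      rw [Complex.sq_norm, Complex.normSq_apply, hd]
      simp only [map_mul, Complex.conj_I, Complex.conj_ofReal, Complex.add_re, Complex.add_im,
        Complex.mul_im, Complex.mul_re, Complex.neg_re, Complex.neg_im, Complex.sub_re,
        Complex.sub_im, Complex.conj_re, Complex.conj_im, Complex.I_re, Complex.I_im,
        Complex.ofReal_re, Complex.ofReal_im, h0]
      ring
    exact hexpand ▸ hpos
  have hd0 : ‖d‖ ^ 2 = 0 := by
    by_contra hne
    have h := hform (((⟪y, y'⟫_ℂ).im + 1) / ‖d‖ ^ 2)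
    rw [div_mul_cancel₀ _ hne] at h
    linarith
  exact (sub_eq_zero.1 (norm_eq_zero.1 (sq_eq_zero_iff.1 hd0))).symm

lemma IsDissipative.neg_inverse (hT : IsDissipative T) (hker : LinearMap.ker T.toFun = ⊥) :
    IsDissipative (-T.inverse) := by
  rw [isDissipative_iff] at *
  intro x y hxy
  have h := hT _ _ ((mem_graph_neg_inverse hker).1 hxy)
  rwa [inner_neg_left, Complex.neg_im, ← Complex.conj_im, inner_conj_symm] at h

lemma IsDissipative.ker_eq_bot_of_dense_range (hT : IsDissipative T)
    (hrange : Dense (LinearMap.range T.toFun : Set H)) : LinearMap.ker T.toFun = ⊥ := by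
  refine ker_eq_bot_iff.2 fun x hx => hrange.eq_zero_of_inner_right ℂ ?_
  rintro _ ⟨u, rfl⟩
  have h := hT.inner_eq_of_im_eq_zero hx (T.mem_graph u) (by simp)
  rw [inner_zero_left] at h
  exact inner_eq_zero_symm.1 h.symm

lemma IsMaximalDissipative.neg_inverse (hT : IsMaximalDissipative T)
    (hdense : Dense (T.domain : Set H)) (hker : LinearMap.ker T.toFun = ⊥) :
    IsMaximalDissipative (-T.inverse) := by
  refine ⟨hT.1.neg_inverse hker, fun S hS hTS => ?_⟩
  have hrange : Dense (LinearMap.range S.toFun : Set H) := by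
    refine hdense.mono fun x hx => ?_
    have hmem := LinearPMap.le_graph_of_le hTS
      ((mem_graph_neg_inverse (x := T ⟨x, hx⟩) (y := -x) hker).2
        (by rw [neg_neg]; exact T.mem_graph ⟨x, hx⟩))
    obtain ⟨u, -, hu⟩ := (LinearPMap.mem_graph_iff _).1 hmem
    exact ⟨-u, by rw [map_neg]; exact neg_eq_iff_eq_neg.2 hu⟩
  have hkerS := hS.ker_eq_bot_of_dense_range hrange
  have hle : T ≤ -S.inverse := by
    rw [← neg_inverse_neg_inverse hker]
    exact neg_mono (inverse_mono hTS hkerS)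
  rw [← neg_inverse_neg_inverse hkerS, hT.2 _ (hS.neg_inverse hkerS) hle]

lemma isMaximalDissipative_of_surjective (hT : IsDissipative T)
    (hsurj : ∀ h, ∃ a b, (a, b) ∈ T.graph ∧ b + I • a = h) : IsMaximalDissipative T := by
  refine ⟨hT, fun S hS hTS => le_antisymm (LinearPMap.le_of_le_graph ?_) hTS⟩
  rintro ⟨x, y⟩ hxy
  obtain ⟨a, b, hab, heq⟩ := hsurj (y + I • x)
  have hsub : (x - a, y - b) ∈ S.graph :=
    S.graph.sub_mem hxy (LinearPMap.le_graph_of_le hTS hab)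
  have hy : y - b = -(I • (x - a)) := by
    rw [smul_sub, neg_sub, sub_eq_sub_iff_add_eq_add, ← heq, add_comm]
  have him := isDissipative_iff.1 hS _ _ hsub
  rw [hy, inner_neg_right, inner_smul_right, Complex.neg_im, Complex.I_mul_im,
    re_inner_self] at him
  have hxa : x - a = 0 := norm_eq_zero.1 (by nlinarith [norm_nonneg (x - a)])
  rw [hxa, smul_zero, neg_zero] at hy
  rwa [sub_eq_zero.1 hxa, sub_eq_zero.1 hy]

lemma IsDissipative.le_adjoint [CompleteSpace H] {A₀ : H →ₗ.[ℂ] H} (hT : IsDissipative T)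
    (hA₀ : IsSymmetricOp A₀) (hle : A₀ ≤ T) : T ≤ A₀† := by
  refine LinearPMap.le_of_le_graph ?_
  rintro ⟨y, y'⟩ hy
  exact (mem_graph_adjoint hA₀.1).2 fun a b hab =>
    hT.inner_eq_of_im_eq_zero (LinearPMap.le_graph_of_le hle hab) hy
      (im_inner_eq_zero_of_isFormalAdjoint hA₀.2 hab)

end Dissipative

section Resolvent

variable {H : Type*} [NormedAddCommGroup H] [InnerProductSpace ℂ H] {T A : H →ₗ.[ℂ] H} {z : ℂ}

lemma abs_im_mul_norm_le (hT : T.IsFormalAdjoint T) (z : ℂ) {a b : H} (hab : (a, b) ∈ T.graph) :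
    |z.im| * ‖a‖ ≤ ‖b - z • a‖ := by
  rcases eq_or_ne a 0 with rfl | ha
  · simp
  have him : (⟪a, b - z • a⟫_ℂ).im = -(z.im * ‖a‖ ^ 2) := by
    rw [inner_sub_right, inner_smul_right, Complex.sub_im, Complex.mul_im, im_inner_self,
      re_inner_self, im_inner_eq_zero_of_isFormalAdjoint hT hab]
    ring
  have h : |z.im| * ‖a‖ * ‖a‖ ≤ ‖b - z • a‖ * ‖a‖ :=
    calc |z.im| * ‖a‖ * ‖a‖ = |(⟪a, b - z • a⟫_ℂ).im| := by
          rw [him, abs_neg, abs_mul, abs_sq]; ring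
      _ ≤ ‖⟪a, b - z • a⟫_ℂ‖ := Complex.abs_im_le_norm _
      _ ≤ ‖a‖ * ‖b - z • a‖ := norm_inner_le_norm _ _
      _ = ‖b - z • a‖ * ‖a‖ := mul_comm _ _
  exact le_of_mul_le_mul_right h (norm_pos_iff.2 ha)

lemma injective_sub_smul (hT : T.IsFormalAdjoint T) (hz : z.im ≠ 0) :
    Function.Injective (T.toFun - z • T.domain.subtype) := by
  refine (injective_iff_map_eq_zero _).2 fun f hf => Subtype.ext (norm_eq_zero.1 ?_)
  have h := abs_im_mul_norm_le hT z (T.mem_graph f)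
  rw [show T f - z • (f : H) = 0 from hf, norm_zero] at h
  exact (nonpos_of_mul_nonpos_right h (abs_pos.2 hz)).antisymm (norm_nonneg _)

variable [CompleteSpace H]

lemma isClosed_range_sub_smul (hT : T.IsFormalAdjoint T) (hclosed : T.IsClosed) (hz : z.im ≠ 0) :
    IsClosed (LinearMap.range (T.toFun - z • T.domain.subtype) : Set H) := by
  let L : T.graph →L[ℂ] H :=
    (ContinuousLinearMap.snd ℂ H H - z • ContinuousLinearMap.fst ℂ H H) ∘L T.graph.subtypeL
  have hbound : ∀ p : T.graph, ‖p‖ ≤ (1 + (1 + ‖z‖₊) / ‖z.im‖₊ : NNReal) * ‖L p‖ := by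
    rintro ⟨⟨a, b⟩, hab⟩
    have hz' : 0 < |z.im| := abs_pos.2 hz
    have ha : ‖a‖ ≤ ‖b - z • a‖ / |z.im| :=
      (le_div_iff₀' hz').2 (abs_im_mul_norm_le hT z hab)
    have hb : ‖b‖ ≤ ‖b - z • a‖ + ‖z‖ * ‖a‖ := by
      simpa only [norm_smul, sub_add_cancel] using norm_add_le (b - z • a) (z • a)
    have hexpand : ((1 + (1 + ‖z‖₊) / ‖z.im‖₊ : NNReal) : ℝ) * ‖b - z • a‖ =
        ‖b - z • a‖ + ‖b - z • a‖ / |z.im| + ‖z‖ * (‖b - z • a‖ / |z.im|) := by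
      push_cast
      rw [Real.norm_eq_abs]
      ring
    change max ‖a‖ ‖b‖ ≤ _ * ‖b - z • a‖
    rw [hexpand]
    have hprod := mul_le_mul_of_nonneg_left ha (norm_nonneg z)
    refine max_le ?_ ?_ <;> linarith [norm_nonneg (b - z • a), norm_nonneg a,
      mul_nonneg (norm_nonneg z) (norm_nonneg a)]
  have hrange : (LinearMap.range (T.toFun - z • T.domain.subtype) : Set H) = Set.range L := by
    ext y
    constructor
    · rintro ⟨f, rfl⟩
      exact ⟨⟨_, T.mem_graph f⟩, rfl⟩
    · rintro ⟨⟨⟨a, b⟩, hab⟩, rfl⟩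
      obtain ⟨f, rfl, rfl⟩ := (LinearPMap.mem_graph_iff _).1 hab
      exact ⟨f, rfl⟩
  have : CompleteSpace T.graph := hclosed.completeSpace_coe
  rw [hrange]
  exact (L.antilipschitz_of_bound hbound).isClosed_range L.uniformContinuous

lemma orthogonal_range_sub_smul (hT : Dense (T.domain : Set H)) (z : ℂ) :
    (LinearMap.range (T.toFun - z • T.domain.subtype))ᗮ = defectSpace T (conj z) := by
  ext u
  rw [mem_defectSpace, mem_graph_adjoint hT, Submodule.mem_orthogonal]
  have hiff : ∀ a b : H, ⟪b - z • a, u⟫_ℂ = 0 ↔ ⟪b, u⟫_ℂ = ⟪a, conj z • u⟫_ℂ := by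
    intro a b
    rw [inner_sub_left, inner_smul_left, inner_smul_right, sub_eq_zero]
  constructor
  · intro h a b hab
    obtain ⟨f, rfl, rfl⟩ := (LinearPMap.mem_graph_iff _).1 hab
    exact (hiff _ _).1 (h _ ⟨f, rfl⟩)
  · rintro h _ ⟨f, rfl⟩
    exact (hiff _ _).2 (h _ _ (T.mem_graph f))

lemma range_sub_smul (hT : IsSymmetricOp T) (hclosed : T.IsClosed) (hz : z.im ≠ 0) :
    LinearMap.range (T.toFun - z • T.domain.subtype) = (defectSpace T (conj z))ᗮ := by
  rw [← orthogonal_range_sub_smul hT.1, Submodule.orthogonal_orthogonal_eq_closure,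
    (isClosed_range_sub_smul hT.2 hclosed hz).submodule_topologicalClosure_eq]

lemma isFormalAdjoint_of_isSelfAdjoint (hA : IsSelfAdjoint A) : A.IsFormalAdjoint A := by
  have h := LinearPMap.adjoint_isFormalAdjoint hA.dense_domain
  rwa [LinearPMap.isSelfAdjoint_def.1 hA] at h

lemma defectSpace_eq_bot_of_isSelfAdjoint (hA : IsSelfAdjoint A) (hz : z.im ≠ 0) :
    defectSpace A z = ⊥ := by
  refine (Submodule.eq_bot_iff _).2 fun u hu => norm_eq_zero.1 ?_
  rw [mem_defectSpace, LinearPMap.isSelfAdjoint_def.1 hA] at hu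
  have h := abs_im_mul_norm_le (isFormalAdjoint_of_isSelfAdjoint hA) z hu
  rw [sub_self, norm_zero] at h
  exact (nonpos_of_mul_nonpos_right h (abs_pos.2 hz)).antisymm (norm_nonneg _)

lemma bijective_sub_smul (hA : IsSelfAdjoint A) (hz : z.im ≠ 0) :
    Function.Bijective fun f : A.domain => A f - z • (f : H) := by
  have hformal := isFormalAdjoint_of_isSelfAdjoint hA
  refine ⟨injective_sub_smul hformal hz, LinearMap.range_eq_top.1
    (?_ : LinearMap.range (A.toFun - z • A.domain.subtype) = ⊤)⟩
  rw [range_sub_smul ⟨hA.dense_domain, hformal⟩ hA.isClosed hz,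
    defectSpace_eq_bot_of_isSelfAdjoint hA (by rwa [Complex.conj_im, neg_ne_zero]),
    Submodule.bot_orthogonal_eq_top]

end Resolvent

section WeylFunction

variable {H : Type*} [NormedAddCommGroup H] [InnerProductSpace ℂ H] {A : H →ₗ.[ℂ] H} {z : ℂ}

/-- The function `z ↦ ((zA + I)(A - zI)⁻¹ g, g)`, which is the Weyl–Titchmarsh function of `A` when
`g` is the deficiency element `g₊`. The inverse is `Function.invFun`, so the value means nothing
where `A - zI` is not bijective. -/
noncomputable def weylFunction (A : H →ₗ.[ℂ] H) (g : H) (z : ℂ) : ℂ :=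
  let f := Function.invFun (fun f : A.domain => A f - z • (f : H)) g
  ⟪g, z • A f + (f : H)⟫_ℂ

/- `Im ⟪b - z a, z b + a⟫ = Im z (‖a‖² + ‖b‖²)` if `⟪a, b⟫` is real. -/
lemma im_inner_sub_smul_nonneg (hA : A.IsFormalAdjoint A) (hz : 0 ≤ z.im) {a b : H}
    (hab : (a, b) ∈ A.graph) : 0 ≤ (⟪b - z • a, z • b + a⟫_ℂ).im := by
  have hba : ⟪b, a⟫_ℂ = ⟪a, b⟫_ℂ := isFormalAdjoint_iff.1 hA _ _ _ _ hab hab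
  have him : (⟪b - z • a, z • b + a⟫_ℂ).im = z.im * (‖a‖ ^ 2 + ‖b‖ ^ 2) := by
    simp only [inner_sub_left, inner_add_right, inner_smul_left, inner_smul_right, hba]
    simp only [Complex.add_im, Complex.sub_im, Complex.mul_im, Complex.sub_re, Complex.mul_re,
      Complex.conj_re, Complex.conj_im, im_inner_self, re_inner_self,
      im_inner_eq_zero_of_isFormalAdjoint hA hab]
    ring
  rw [him]
  positivity

variable [CompleteSpace H]

lemma weylFunction_eq (hA : IsSelfAdjoint A) (hz : z.im ≠ 0) {g : H} {f : A.domain}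
    (hf : A f - z • (f : H) = g) : weylFunction A g z = ⟪g, z • A f + (f : H)⟫_ℂ := by
  have h : Function.invFun (fun f : A.domain => A f - z • (f : H)) g = f :=
    (congrArg _ hf.symm).trans (Function.leftInverse_invFun (bijective_sub_smul hA hz).1 f)
  rw [weylFunction, h]

lemma weylFunction_smul (hA : IsSelfAdjoint A) (hz : z.im ≠ 0) (c : ℂ) (g : H) :
    weylFunction A (c • g) z = conj c * c * weylFunction A g z := by
  obtain ⟨f, hf⟩ := (bijective_sub_smul hA hz).2 g
  have hcf : A (c • f) - z • ((c • f : A.domain) : H) = c • g := by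
    rw [LinearPMap.map_smul, Submodule.coe_smul, smul_comm z c, ← smul_sub]
    exact congrArg _ hf
  rw [weylFunction_eq hA hz hf, weylFunction_eq hA hz hcf, LinearPMap.map_smul,
    Submodule.coe_smul, smul_comm z c, ← smul_add, inner_smul_left, inner_smul_right, mul_assoc]

lemma weylFunction_smul_of_norm_eq_one (hA : IsSelfAdjoint A) (hz : z.im ≠ 0) {c : ℂ}
    (hc : ‖c‖ = 1) (g : H) : weylFunction A (c • g) z = weylFunction A g z := by
  rw [weylFunction_smul hA hz, Complex.conj_mul', hc, Complex.ofReal_one, one_pow, one_mul]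

lemma im_weylFunction_nonneg (hA : IsSelfAdjoint A) (g : H) (hz : 0 < z.im) :
    0 ≤ (weylFunction A g z).im := by
  obtain ⟨f, hf⟩ := (bijective_sub_smul hA hz.ne').2 g
  rw [weylFunction_eq hA hz.ne' hf, ← hf]
  exact im_inner_sub_smul_nonneg (isFormalAdjoint_of_isSelfAdjoint hA) hz.le (A.mem_graph f)

end WeylFunction

section DefectElements

variable {H : Type*} [NormedAddCommGroup H] [InnerProductSpace ℂ H] [CompleteSpace H]
  {A₀ A : H →ₗ.[ℂ] H} {z w : ℂ}

lemma IsSelfAdjointExtension.le_adjoint (hA : IsSelfAdjointExtension A₀ A)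
    (hd : Dense (A₀.domain : Set H)) : A ≤ A₀† := by
  have h := adjoint_anti hd hA.1
  rwa [LinearPMap.isSelfAdjoint_def.1 hA.2] at h

lemma eq_zero_of_mem_defectSpace (hA : IsSelfAdjointExtension A₀ A)
    (hd : Dense (A₀.domain : Set H)) (hz : z.im ≠ 0) {u : H} (hu : u ∈ defectSpace A₀ z)
    (huA : u ∈ A.domain) : u = 0 := by
  obtain ⟨v, hv⟩ := LinearPMap.mem_domain_iff.1 huA
  obtain rfl := LinearPMap.mem_graph_snd_inj _ (mem_defectSpace.1 hu)
    (LinearPMap.le_graph_of_le (hA.le_adjoint hd) hv) rfl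
  rw [← Submodule.mem_bot ℂ, ← defectSpace_eq_bot_of_isSelfAdjoint hA.2 hz, mem_defectSpace,
    LinearPMap.isSelfAdjoint_def.1 hA.2]
  exact hv

lemma add_smul_mem_defectSpace (hA : IsSelfAdjointExtension A₀ A)
    (hd : Dense (A₀.domain : Set H)) {u : H} (hu : u ∈ defectSpace A₀ w) {f : A.domain}
    (hf : A f - z • (f : H) = u) : u + (z - w) • (f : H) ∈ defectSpace A₀ z := by
  have h := A₀†.graph.add_mem (mem_defectSpace.1 hu) (A₀†.graph.smul_mem (z - w)
    (LinearPMap.le_graph_of_le (hA.le_adjoint hd) (A.mem_graph f)))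
  rw [Prod.smul_mk, Prod.mk_add_mk, sub_eq_iff_eq_add.1 hf] at h
  rw [mem_defectSpace]
  convert h using 2
  module

lemma exists_mem_defectSpace_sub_mem_domain (hA : IsSelfAdjointExtension A₀ A)
    (hd : Dense (A₀.domain : Set H)) (hz : z.im ≠ 0) {u : H} (hu : u ∈ defectSpace A₀ w) :
    ∃ v ∈ defectSpace A₀ z, v - u ∈ A.domain := by
  obtain ⟨f, hf⟩ := (bijective_sub_smul hA.2 hz).2 u
  refine ⟨_, add_smul_mem_defectSpace hA hd hu hf, ?_⟩
  rw [add_sub_cancel_left]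
  exact A.domain.smul_mem _ f.2

lemma exists_smul_eq_of_mem_defectSpace (hA : IsSelfAdjointExtension A₀ A)
    (hd : Dense (A₀.domain : Set H)) (hz : z.im ≠ 0) (hw : w.im ≠ 0) {u v : H}
    (hu : defectSpace A₀ w = ℂ ∙ u) (hv : v ∈ defectSpace A₀ z) (hvu : v - u ∈ A.domain) {x : H}
    (hx : x ∈ defectSpace A₀ z) : ∃ c : ℂ, c • v = x := by
  obtain ⟨y, hy, hyx⟩ := exists_mem_defectSpace_sub_mem_domain hA hd hw hx
  obtain ⟨c, rfl⟩ := Submodule.mem_span_singleton.1 (hu ▸ hy)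
  refine ⟨c, sub_eq_zero.1 (eq_zero_of_mem_defectSpace hA hd hz
    (Submodule.sub_mem _ (Submodule.smul_mem _ c hv) hx) ?_)⟩
  have hsplit : c • v - x = c • (v - u) + (c • u - x) := by module
  rw [hsplit]
  exact A.domain.add_mem (A.domain.smul_mem c hvu) hyx

lemma exists_add_smul_of_mem_graph_adjoint (hA : IsSelfAdjointExtension A₀ A)
    (hd : Dense (A₀.domain : Set H)) (hz : z.im ≠ 0) {g : H} (hg : defectSpace A₀ z = ℂ ∙ g)
    {u v : H} (huv : (u, v) ∈ A₀†.graph) :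
    ∃ (f : A.domain) (c : ℂ), u = f + c • g ∧ v = A f + c • z • g := by
  obtain ⟨f, hf : A f - z • (f : H) = v - z • u⟩ := (bijective_sub_smul hA.2 hz).2 (v - z • u)
  have hdiff : v - A f = z • (u - (f : H)) := by
    rw [smul_sub, sub_eq_sub_iff_sub_eq_sub, ← hf]
  have hmem : u - f ∈ defectSpace A₀ z := by
    rw [mem_defectSpace, ← hdiff]
    exact A₀†.graph.sub_mem huv
      (LinearPMap.le_graph_of_le (hA.le_adjoint hd) (A.mem_graph f))
  obtain ⟨c, hc⟩ := Submodule.mem_span_singleton.1 (hg ▸ hmem)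
  exact ⟨f, c, by rw [hc, add_sub_cancel], by rw [smul_comm, hc, ← hdiff, add_sub_cancel]⟩

end DefectElements

section DeficiencyPair

variable {H : Type*} [NormedAddCommGroup H] [InnerProductSpace ℂ H] [CompleteSpace H]
  {A₀ A : H →ₗ.[ℂ] H} {gp gm gp' gm' : H} {z : ℂ}

lemma HasDeficiencyIndices.defectSpace_I_eq_span {n : Cardinal}
    (hind : HasDeficiencyIndices A₀ 1 n) {g : H} (hg : g ∈ defectSpace A₀ I) (hg0 : g ≠ 0) :
    defectSpace A₀ I = ℂ ∙ g := by
  have hrank : Module.finrank ℂ (defectSpace A₀ I) = 1 :=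
    Module.rank_eq_one_iff_finrank_eq_one.1 hind.1
  refine le_antisymm (fun x hx => ?_) ((Submodule.span_singleton_le_iff_mem _ _).2 hg)
  obtain ⟨c, hc⟩ := exists_smul_eq_of_finrank_eq_one hrank
    (x := (⟨g, hg⟩ : defectSpace A₀ I)) (Subtype.coe_ne_coe.1 hg0) ⟨x, hx⟩
  exact Submodule.mem_span_singleton.2 ⟨c, congrArg Subtype.val hc⟩

lemma IsDeficiencyPair.map_sub (h : IsDeficiencyPair A₀ A gp gm) (hle : A ≤ A₀†) :
    (gp - gm, I • gp + I • gm) ∈ A.graph := by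
  obtain ⟨y, hy⟩ := LinearPMap.mem_domain_iff.1 h.sub_mem
  have hsub := A₀†.graph.sub_mem (mem_defectSpace.1 h.mem_plus) (mem_defectSpace.1 h.mem_minus)
  rw [Prod.mk_sub_mk, neg_smul, sub_neg_eq_add] at hsub
  rwa [← LinearPMap.mem_graph_snd_inj _ (LinearPMap.le_graph_of_le hle hy) hsub rfl]

lemma IsDeficiencyPair.exists_smul (h : IsDeficiencyPair A₀ A gp gm)
    (hA : IsSelfAdjointExtension A₀ A) (hd : Dense (A₀.domain : Set H)) {n : Cardinal}
    (hind : HasDeficiencyIndices A₀ 1 n) (h' : IsDeficiencyPair A₀ A gp' gm') :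
    ∃ c : ℂ, ‖c‖ = 1 ∧ gp' = c • gp ∧ gm' = c • gm := by
  have hspan := hind.defectSpace_I_eq_span h.mem_plus
    (ne_zero_of_norm_ne_zero (h.norm_plus ▸ one_ne_zero))
  obtain ⟨c, rfl⟩ := Submodule.mem_span_singleton.1 (hspan ▸ h'.mem_plus)
  have hc : ‖c‖ = 1 := by simpa only [norm_smul, h.norm_plus, mul_one] using h'.norm_plus
  refine ⟨c, hc, rfl, (sub_eq_zero.1 (eq_zero_of_mem_defectSpace hA hd (z := -I) (by simp)
    (Submodule.sub_mem _ (Submodule.smul_mem _ c h.mem_minus) h'.mem_minus) ?_)).symm⟩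
  have hsplit : c • gm - gm' = (c • gp - gm') - c • (gp - gm) := by module
  rw [hsplit]
  exact A.domain.sub_mem h'.sub_mem (A.domain.smul_mem c h.sub_mem)

lemma IsDeficiencyPair.mul_inner_plus (h : IsDeficiencyPair A₀ A gp gm) {f : A.domain}
    (hf : A f - z • (f : H) = gp) :
    (z + I) * ⟪gp, gp + (z - I) • (f : H)⟫_ℂ = ⟪gp, z • A f + (f : H)⟫_ℂ + I := by
  have hvec : (z + I) • (gp + (z - I) • (f : H)) =
      (z • A f + (-(I * I)) • (f : H)) + I • gp := by
    rw [← hf]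
    module
  rw [← inner_smul_right, hvec, Complex.I_mul_I, neg_neg, one_smul, inner_add_right,
    inner_smul_right _ gp, inner_self_eq_one_of_norm_eq_one h.norm_plus, mul_one]

/- Moving `gm` to `gp` by the symmetry of `A` on `gp - gm` and `f` reduces this to
`IsDeficiencyPair.mul_inner_plus` with `I` replaced by `-I`. -/
lemma IsDeficiencyPair.mul_inner_minus (h : IsDeficiencyPair A₀ A gp gm)
    (hA : IsSelfAdjointExtension A₀ A) (hd : Dense (A₀.domain : Set H)) {f : A.domain}
    (hf : A f - z • (f : H) = gp) :
    (z - I) * ⟪gm, gp + (z - I) • (f : H)⟫_ℂ = ⟪gp, z • A f + (f : H)⟫_ℂ - I := by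
  have hshift : ⟪gm, gp + (z - I) • (f : H)⟫_ℂ = ⟪gp, A f + I • (f : H)⟫_ℂ := by
    have hsymm := isFormalAdjoint_iff.1 (isFormalAdjoint_of_isSelfAdjoint hA.2) _ _ _ _
      (h.map_sub (hA.le_adjoint hd)) (A.mem_graph f)
    have hvec : gp + (z - I) • (f : H) = A f - I • (f : H) := by
      rw [← hf]
      module
    rw [inner_add_left, inner_smul_left, inner_smul_left, Complex.conj_I, inner_sub_left] at hsymm
    rw [hvec, inner_sub_right, inner_add_right, inner_smul_right, inner_smul_right]
    linear_combination hsymm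
  have hvec : (z - I) • (A f + I • (f : H)) = (z • A f + (-(I * I)) • (f : H)) - I • gp := by
    rw [← hf]
    module
  rw [hshift, ← inner_smul_right, hvec, Complex.I_mul_I, neg_neg, one_smul, inner_sub_right,
    inner_smul_right _ gp, inner_self_eq_one_of_norm_eq_one h.norm_plus, mul_one]

end DeficiencyPair

section CharacteristicFunctions

variable {H : Type*} [NormedAddCommGroup H] [InnerProductSpace ℂ H] [CompleteSpace H]
  {A₀ A : H →ₗ.[ℂ] H} {gp gm : H}

lemma IsDeficiencyPair.isWeylTitchmarshFunction (h : IsDeficiencyPair A₀ A gp gm)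
    (hA : IsSelfAdjointExtension A₀ A) (hd : Dense (A₀.domain : Set H)) {n : Cardinal}
    (hind : HasDeficiencyIndices A₀ 1 n) : IsWeylTitchmarshFunction A₀ A (weylFunction A gp) where
  exists_pair := ⟨gp, gm, h⟩
  bijective _ hz := bijective_sub_smul hA.2 hz.ne'
  formula gp' gm' h' z hz f hf := by
    obtain ⟨c, hc, rfl, -⟩ := h.exists_smul hA hd hind h'
    rw [← weylFunction_eq hA.2 hz.ne' hf, weylFunction_smul_of_norm_eq_one hA.2 hz.ne' hc]

lemma add_I_ne_zero {M : ℂ} (hM : 0 ≤ M.im) : M + I ≠ 0 := by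
  intro h
  have him := congrArg Complex.im h
  rw [Complex.add_im, Complex.I_im, Complex.zero_im] at him
  linarith

lemma norm_sub_I_div_add_I_le_one {M : ℂ} (hM : 0 ≤ M.im) : ‖(M - I) / (M + I)‖ ≤ 1 := by
  rw [norm_div, div_le_one (norm_pos_iff.2 (add_I_ne_zero hM)), ← sq_le_sq₀ (norm_nonneg _)
    (norm_nonneg _), Complex.sq_norm, Complex.sq_norm, Complex.normSq_apply, Complex.normSq_apply]
  simp only [Complex.sub_re, Complex.sub_im, Complex.add_re, Complex.add_im, Complex.I_re,
    Complex.I_im]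
  nlinarith

lemma IsDeficiencyPair.cayley_weylFunction_eq (h : IsDeficiencyPair A₀ A gp gm)
    (hA : IsSelfAdjointExtension A₀ A) (hd : Dense (A₀.domain : Set H)) {n : Cardinal}
    (hind : HasDeficiencyIndices A₀ 1 n) {z : ℂ} (hz : 0 < z.im) {g : H}
    (hg : g ∈ defectSpace A₀ z) (hg0 : g ≠ 0) :
    ⟪gp, g⟫_ℂ ≠ 0 ∧ (weylFunction A gp z - I) / (weylFunction A gp z + I) =
      (z - I) / (z + I) * (⟪gm, g⟫_ℂ / ⟪gp, g⟫_ℂ) := by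
  obtain ⟨f, hf⟩ := (bijective_sub_smul hA.2 hz.ne').2 gp
  have hdiff : gp + (z - I) • (f : H) - gp ∈ A.domain := by
    rw [add_sub_cancel_left]
    exact A.domain.smul_mem _ f.2
  obtain ⟨d, rfl⟩ := exists_smul_eq_of_mem_defectSpace hA hd hz.ne' (by simp)
    (hind.defectSpace_I_eq_span h.mem_plus (ne_zero_of_norm_ne_zero (h.norm_plus ▸ one_ne_zero)))
    (add_smul_mem_defectSpace hA hd h.mem_plus hf) hdiff hg
  have hd0 : d ≠ 0 := left_ne_zero_of_smul hg0
  have hplus := h.mul_inner_plus hf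
  have hminus := h.mul_inner_minus hA hd hf
  rw [← weylFunction_eq hA.2 hz.ne' hf] at hplus hminus
  have hM : weylFunction A gp z + I ≠ 0 := add_I_ne_zero (im_weylFunction_nonneg hA.2 gp hz)
  have hinner : ⟪gp, gp + (z - I) • (f : H)⟫_ℂ ≠ 0 := right_ne_zero_of_mul (hplus ▸ hM)
  rw [inner_smul_right gp, inner_smul_right gm, mul_div_mul_left _ _ hd0, div_mul_div_comm,
    hminus, hplus]
  exact ⟨mul_ne_zero hd0 hinner, rfl⟩

lemma IsDeficiencyPair.isLivsicFunction_cayley (h : IsDeficiencyPair A₀ A gp gm)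
    (hA : IsSelfAdjointExtension A₀ A) (hd : Dense (A₀.domain : Set H)) {n : Cardinal}
    (hind : HasDeficiencyIndices A₀ 1 n) :
    IsLivsicFunction A₀ A fun z => (weylFunction A gp z - I) / (weylFunction A gp z + I) where
  exists_pair := ⟨gp, gm, h⟩
  exists_defect z hz := by
    have hne := ne_zero_of_norm_ne_zero (h.norm_plus ▸ one_ne_zero)
    obtain ⟨v, hv, hvA⟩ := exists_mem_defectSpace_sub_mem_domain hA hd hz.ne' h.mem_plus
    refine ⟨v, hv, ?_⟩
    rintro rfl
    rw [zero_sub, neg_mem_iff] at hvA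
    exact hne (eq_zero_of_mem_defectSpace hA hd (by simp) h.mem_plus hvA)
  formula gp' gm' h' z hz g hg hg0 := by
    obtain ⟨c, hc, hgp, -⟩ := h.exists_smul hA hd hind h'
    rw [← weylFunction_smul_of_norm_eq_one hA.2 hz.ne' hc, ← hgp]
    exact h'.cayley_weylFunction_eq hA hd hind hz hg hg0

lemma IsLivsicFunction.norm_le_one {s : ℂ → ℂ} (hs : IsLivsicFunction A₀ A s)
    (hA : IsSelfAdjointExtension A₀ A) (hd : Dense (A₀.domain : Set H)) {n : Cardinal}
    (hind : HasDeficiencyIndices A₀ 1 n) {z : ℂ} (hz : 0 < z.im) : ‖s z‖ ≤ 1 := by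
  obtain ⟨gp, gm, h⟩ := hs.exists_pair
  obtain ⟨g, hg, hg0⟩ := hs.exists_defect z hz
  rw [(hs.formula gp gm h z hz g hg hg0).2, ← (h.cayley_weylFunction_eq hA hd hind hz hg hg0).2]
  exact norm_sub_I_div_add_I_le_one (im_weylFunction_nonneg hA.2 gp hz)

end CharacteristicFunctions

section VonNeumannExtension

variable {H : Type*} [NormedAddCommGroup H] [InnerProductSpace ℂ H] [CompleteSpace H]
  {A₀ : H →ₗ.[ℂ] H} {gp gm : H}

/-- The extension of `A₀` by the line through `gp - gm`, where `gp ∈ Ker (A₀* - iI)` and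
`gm ∈ Ker (A₀* + iI)`, as in von Neumann's extension theory. -/
noncomputable def vonNeumannExtension (A₀ : H →ₗ.[ℂ] H) (gp gm : H) : H →ₗ.[ℂ] H :=
  A₀†.domRestrict (A₀.domain ⊔ ℂ ∙ (gp - gm))

lemma sub_mem_graph_adjoint (hp : gp ∈ defectSpace A₀ I) (hm : gm ∈ defectSpace A₀ (-I)) :
    (gp - gm, I • (gp + gm)) ∈ A₀†.graph := by
  have h := A₀†.graph.sub_mem (mem_defectSpace.1 hp) (mem_defectSpace.1 hm)
  rwa [Prod.mk_sub_mk, neg_smul, sub_neg_eq_add, ← smul_add] at h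

lemma mem_graph_vonNeumannExtension (hA₀ : IsSymmetricOp A₀) (hp : gp ∈ defectSpace A₀ I)
    (hm : gm ∈ defectSpace A₀ (-I)) {x y : H} :
    (x, y) ∈ (vonNeumannExtension A₀ gp gm).graph ↔ ∃ a b, (a, b) ∈ A₀.graph ∧
      ∃ c : ℂ, x = a + c • (gp - gm) ∧ y = b + c • I • (gp + gm) := by
  have hle : A₀ ≤ A₀† := hA₀.2.le_adjoint hA₀.1
  have hline := sub_mem_graph_adjoint hp hm
  rw [vonNeumannExtension, mem_graph_domRestrict, Submodule.mem_sup]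
  constructor
  · rintro ⟨⟨a, ha, _, hu, rfl⟩, hxy⟩
    obtain ⟨c, rfl⟩ := Submodule.mem_span_singleton.1 hu
    have h := A₀†.graph.add_mem (LinearPMap.le_graph_of_le hle (A₀.mem_graph ⟨a, ha⟩))
      (A₀†.graph.smul_mem c hline)
    exact ⟨a, _, A₀.mem_graph ⟨a, ha⟩, c, rfl, LinearPMap.mem_graph_snd_inj _ hxy h rfl⟩
  · rintro ⟨a, b, hab, c, rfl, rfl⟩
    exact ⟨⟨a, LinearPMap.mem_domain_of_mem_graph hab, _,
      Submodule.smul_mem _ c (Submodule.mem_span_singleton_self _), rfl⟩,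
      A₀†.graph.add_mem (LinearPMap.le_graph_of_le hle hab) (A₀†.graph.smul_mem c hline)⟩

lemma vonNeumannExtension_le_adjoint : vonNeumannExtension A₀ gp gm ≤ A₀† :=
  LinearPMap.domRestrict_le

lemma sub_mem_vonNeumannExtension_domain (hp : gp ∈ defectSpace A₀ I)
    (hm : gm ∈ defectSpace A₀ (-I)) : gp - gm ∈ (vonNeumannExtension A₀ gp gm).domain :=
  ⟨Submodule.mem_sup_right (Submodule.mem_span_singleton_self _),
    LinearPMap.mem_domain_of_mem_graph (sub_mem_graph_adjoint hp hm)⟩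

lemma le_vonNeumannExtension (hA₀ : IsSymmetricOp A₀) (hp : gp ∈ defectSpace A₀ I)
    (hm : gm ∈ defectSpace A₀ (-I)) : A₀ ≤ vonNeumannExtension A₀ gp gm := by
  refine LinearPMap.le_of_le_graph ?_
  rintro ⟨a, b⟩ hab
  exact (mem_graph_vonNeumannExtension hA₀ hp hm).2
    ⟨a, b, hab, 0, by rw [zero_smul, add_zero], by rw [zero_smul, add_zero]⟩

/- The mixed terms are `c ⟪a, v⟫` and `conj c ⟪u, b⟫` with `⟪u, b⟫ = ⟪v, a⟫`, conjugate to each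
other, so they contribute nothing to the imaginary part. -/
lemma im_inner_add_smul (hA₀ : IsSymmetricOp A₀) {a b u v : H} (hab : (a, b) ∈ A₀.graph)
    (huv : (u, v) ∈ A₀†.graph) (c : ℂ) :
    (⟪a + c • u, b + c • v⟫_ℂ).im = ‖c‖ ^ 2 * (⟪u, v⟫_ℂ).im := by
  have hub : ⟪u, b⟫_ℂ = conj ⟪a, v⟫_ℂ := by
    rw [← (mem_graph_adjoint hA₀.1).1 huv a b hab, inner_conj_symm]
  rw [Complex.sq_norm, Complex.normSq_apply]
  simp only [inner_add_left, inner_add_right, inner_smul_left, inner_smul_right, hub]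
  simp only [Complex.add_im, Complex.add_re, Complex.mul_im, Complex.mul_re, Complex.conj_re,
    Complex.conj_im, im_inner_eq_zero_of_isFormalAdjoint hA₀.2 hab]
  ring

lemma im_inner_vonNeumannExtension (hA₀ : IsSymmetricOp A₀) (hp : gp ∈ defectSpace A₀ I)
    (hm : gm ∈ defectSpace A₀ (-I)) {a b : H} (hab : (a, b) ∈ A₀.graph) (c : ℂ) :
    (⟪a + c • (gp - gm), b + c • I • (gp + gm)⟫_ℂ).im = ‖c‖ ^ 2 * (‖gp‖ ^ 2 - ‖gm‖ ^ 2) := by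
  rw [im_inner_add_smul hA₀ hab (sub_mem_graph_adjoint hp hm), im_inner_sub_smul_add]

lemma isDissipative_vonNeumannExtension (hA₀ : IsSymmetricOp A₀) (hp : gp ∈ defectSpace A₀ I)
    (hm : gm ∈ defectSpace A₀ (-I)) (hle : ‖gm‖ ≤ ‖gp‖) :
    IsDissipative (vonNeumannExtension A₀ gp gm) := by
  refine isDissipative_iff.2 fun x y hxy => ?_
  obtain ⟨a, b, hab, c, rfl, rfl⟩ := (mem_graph_vonNeumannExtension hA₀ hp hm).1 hxy
  rw [im_inner_vonNeumannExtension hA₀ hp hm hab]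
  exact mul_nonneg (sq_nonneg _) (sub_nonneg.2 (pow_le_pow_left₀ (norm_nonneg _) hle 2))

/- `A₀ + iI` is onto the orthogonal complement of `gp`, and the extension maps `gp - gm` to
`2i gp` under adding `iI`. -/
lemma isMaximalDissipative_vonNeumannExtension (hA₀ : IsSymmetricOp A₀) (hclosed : A₀.IsClosed)
    (hspan : defectSpace A₀ I = ℂ ∙ gp) (hm : gm ∈ defectSpace A₀ (-I)) (hle : ‖gm‖ ≤ ‖gp‖) :
    IsMaximalDissipative (vonNeumannExtension A₀ gp gm) := by
  have hp : gp ∈ defectSpace A₀ I := hspan ▸ Submodule.mem_span_singleton_self gp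
  refine isMaximalDissipative_of_surjective
    (isDissipative_vonNeumannExtension hA₀ hp hm hle) fun h => ?_
  have hrange := range_sub_smul hA₀ hclosed (z := -I) (by simp)
  rw [map_neg, Complex.conj_I, neg_neg, hspan] at hrange
  obtain ⟨_, hg, w, hw, rfl⟩ := (ℂ ∙ gp).exists_add_mem_mem_orthogonal h
  obtain ⟨c, rfl⟩ := Submodule.mem_span_singleton.1 hg
  obtain ⟨f, rfl⟩ := hrange ▸ hw
  refine ⟨_, _, (mem_graph_vonNeumannExtension hA₀ hp hm).2
    ⟨f, A₀ f, A₀.mem_graph f, c / (2 * I), rfl, rfl⟩, ?_⟩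
  have hc : c / (2 * I) * (2 * I) = c :=
    div_mul_cancel₀ _ (mul_ne_zero two_ne_zero Complex.I_ne_zero)
  calc A₀ f + (c / (2 * I)) • I • (gp + gm) + I • ((f : H) + (c / (2 * I)) • (gp - gm))
      = (c / (2 * I) * (2 * I)) • gp + (A₀ f - -I • (f : H)) := by module
    _ = _ := by rw [hc]; rfl

lemma isQuasiSelfAdjointExtension_vonNeumannExtension (hA₀ : IsSymmetricOp A₀)
    (hp : gp ∈ defectSpace A₀ I) (hm : gm ∈ defectSpace A₀ (-I)) (hlt : ‖gm‖ < ‖gp‖) :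
    IsQuasiSelfAdjointExtension A₀ (vonNeumannExtension A₀ gp gm) := by
  have hle := le_vonNeumannExtension hA₀ hp hm
  have hdense := hA₀.1.mono hle.1
  refine ⟨hle, vonNeumannExtension_le_adjoint, LinearPMap.eq_of_eq_graph (Submodule.ext ?_)⟩
  rintro ⟨x, y⟩
  rw [mem_graph_domRestrict]
  constructor
  · rintro ⟨hx, hxy⟩
    obtain ⟨y', hxy'⟩ := LinearPMap.mem_domain_iff.1 hx
    obtain rfl := LinearPMap.mem_graph_snd_inj _
      (LinearPMap.le_graph_of_le vonNeumannExtension_le_adjoint hxy)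
      (LinearPMap.le_graph_of_le (adjoint_anti hA₀.1 hle) hxy') rfl
    have him : (⟪x, y⟫_ℂ).im = 0 := by
      rw [← Complex.conj_eq_iff_im, inner_conj_symm]
      exact (mem_graph_adjoint hdense).1 hxy' x y hxy
    obtain ⟨a, b, hab, c, rfl, rfl⟩ := (mem_graph_vonNeumannExtension hA₀ hp hm).1 hxy
    rw [im_inner_vonNeumannExtension hA₀ hp hm hab] at him
    have hpos : 0 < ‖gp‖ ^ 2 - ‖gm‖ ^ 2 :=
      sub_pos.2 (pow_lt_pow_left₀ hlt (norm_nonneg _) two_ne_zero)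
    have hc : c = 0 :=
      norm_eq_zero.1 (sq_eq_zero_iff.1 ((mul_eq_zero.1 him).resolve_right hpos.ne'))
    simpa only [hc, zero_smul, add_zero] using hab
  · intro hxy
    refine ⟨LinearPMap.mem_domain_of_mem_graph (y := y) ((mem_graph_adjoint hdense).2 ?_),
      LinearPMap.le_graph_of_le hle hxy⟩
    intro a b hab
    have hadj := LinearPMap.le_graph_of_le vonNeumannExtension_le_adjoint hab
    rw [← inner_conj_symm, ← (mem_graph_adjoint hA₀.1).1 hadj x y hxy, inner_conj_symm]

lemma not_isSelfAdjoint_vonNeumannExtension (hA₀ : IsSymmetricOp A₀)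
    (hp : gp ∈ defectSpace A₀ I) (hm : gm ∈ defectSpace A₀ (-I)) (hlt : ‖gm‖ < ‖gp‖) :
    ¬IsSelfAdjoint (vonNeumannExtension A₀ gp gm) := by
  intro hsa
  have hline := (mem_graph_vonNeumannExtension hA₀ hp hm).2
    ⟨0, 0, A₀.graph.zero_mem, 1, rfl, rfl⟩
  have him := im_inner_eq_zero_of_isFormalAdjoint (isFormalAdjoint_of_isSelfAdjoint hsa) hline
  rw [im_inner_vonNeumannExtension hA₀ hp hm A₀.graph.zero_mem, norm_one, one_pow, one_mul] at him
  have hpos := pow_lt_pow_left₀ hlt (norm_nonneg _) two_ne_zero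
  linarith

end VonNeumannExtension

section RegularTriple

variable {H : Type*} [NormedAddCommGroup H] [InnerProductSpace ℂ H] [CompleteSpace H]
  {𝔄 : OperatorTriple H} {k κ : ℂ}

lemma IsDissipative.eq_zero_of_mem_defectSpace_neg_I {A₀ T : H →ₗ.[ℂ] H} (hT : IsDissipative T)
    (hle : T ≤ A₀†) {g : H} (hg : g ∈ defectSpace A₀ (-I)) (hgT : g ∈ T.domain) : g = 0 := by
  obtain ⟨y, hy⟩ := LinearPMap.mem_domain_iff.1 hgT
  obtain rfl := LinearPMap.mem_graph_snd_inj _ (mem_defectSpace.1 hg)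
    (LinearPMap.le_graph_of_le hle hy) rfl
  have him := isDissipative_iff.1 hT _ _ hy
  rw [neg_smul, inner_neg_right, inner_smul_right, Complex.neg_im, Complex.I_mul_im,
    re_inner_self] at him
  exact norm_eq_zero.1 (by nlinarith [norm_nonneg g])

lemma OperatorTriple.IsRegular.diss_le_adjoint (h : 𝔄.IsRegular) : 𝔄.diss ≤ 𝔄.symm† :=
  h.maximalDissipative.1.le_adjoint h.symmetric h.le_diss

lemma OperatorTriple.IsVonNeumannParameter.eq (hκ : 𝔄.IsVonNeumannParameter κ)
    (h𝔄 : 𝔄.IsRegular) (hk : 𝔄.IsVonNeumannParameter k) : k = κ := by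
  obtain ⟨gp, gm, h⟩ := hκ.exists_pair
  have hmem : (k - κ) • gm ∈ 𝔄.diss.domain := by
    have hsplit : (k - κ) • gm = (gp - κ • gm) - (gp - k • gm) := by module
    rw [hsplit]
    exact 𝔄.diss.domain.sub_mem (hκ.mem_domain _ _ h) (hk.mem_domain _ _ h)
  have hzero := h𝔄.maximalDissipative.1.eq_zero_of_mem_defectSpace_neg_I h𝔄.diss_le_adjoint
    (Submodule.smul_mem _ _ h.mem_minus) hmem
  exact sub_eq_zero.1 ((smul_eq_zero.1 hzero).resolve_right
    (ne_zero_of_norm_ne_zero (h.norm_minus ▸ one_ne_zero)))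

lemma OperatorTriple.IsVonNeumannParameter.iff_eq (hκ : 𝔄.IsVonNeumannParameter κ)
    (h𝔄 : 𝔄.IsRegular) (k : ℂ) : 𝔄.IsVonNeumannParameter k ↔ k = κ :=
  ⟨hκ.eq h𝔄, fun h => h ▸ hκ⟩

lemma OperatorTriple.IsRegular.isVonNeumannParameter (h𝔄 : 𝔄.IsRegular) {gp gm : H}
    (h : IsDeficiencyPair 𝔄.symm 𝔄.ref gp gm) (hκ : ‖κ‖ < 1)
    (hmem : gp - κ • gm ∈ 𝔄.diss.domain) : 𝔄.IsVonNeumannParameter κ where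
  norm_lt_one := hκ
  exists_pair := ⟨gp, gm, h⟩
  mem_domain gp' gm' h' := by
    obtain ⟨c, -, rfl, rfl⟩ :=
      h.exists_smul h𝔄.selfAdjointExtension h𝔄.symmetric.1 h𝔄.indices h'
    rw [smul_comm κ c, ← smul_sub]
    exact 𝔄.diss.domain.smul_mem c hmem

lemma conj_mul_sub_one_ne_zero {s : ℂ} (hκ : ‖κ‖ < 1) (hs : ‖s‖ ≤ 1) : conj κ * s - 1 ≠ 0 := by
  refine sub_ne_zero.2 fun h => ?_
  have hlt : ‖conj κ * s‖ < 1 := by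
    rw [norm_mul, RCLike.norm_conj]
    exact mul_lt_one_of_nonneg_of_lt_one_left (norm_nonneg _) hκ hs
  rw [h, norm_one] at hlt
  exact hlt.false

lemma OperatorTriple.IsRegular.exists_isWeylTitchmarshFunction (h𝔄 : 𝔄.IsRegular)
    (hpair : ∃ gp gm, IsDeficiencyPair 𝔄.symm 𝔄.ref gp gm) :
    ∃ M, IsWeylTitchmarshFunction 𝔄.symm 𝔄.ref M :=
  let ⟨gp, _, h⟩ := hpair
  ⟨weylFunction 𝔄.ref gp,
    h.isWeylTitchmarshFunction h𝔄.selfAdjointExtension h𝔄.symmetric.1 h𝔄.indices⟩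

lemma OperatorTriple.IsRegular.exists_isLivsicFunction (h𝔄 : 𝔄.IsRegular)
    (hpair : ∃ gp gm, IsDeficiencyPair 𝔄.symm 𝔄.ref gp gm) :
    ∃ s, IsLivsicFunction 𝔄.symm 𝔄.ref s :=
  let ⟨_, _, h⟩ := hpair
  ⟨_, h.isLivsicFunction_cayley h𝔄.selfAdjointExtension h𝔄.symmetric.1 h𝔄.indices⟩

lemma OperatorTriple.IsRegular.exists_isCharacteristicFunction (h𝔄 : 𝔄.IsRegular)
    (hκ : 𝔄.IsVonNeumannParameter κ) : ∃ S, 𝔄.IsCharacteristicFunction S := by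
  obtain ⟨s, hs⟩ := h𝔄.exists_isLivsicFunction hκ.exists_pair
  exact ⟨_, s, κ, hs, hκ, fun z hz => ⟨conj_mul_sub_one_ne_zero hκ.norm_lt_one
    (hs.norm_le_one h𝔄.selfAdjointExtension h𝔄.symmetric.1 h𝔄.indices hz), rfl⟩⟩

end RegularTriple

section Transfer

variable {H : Type*} [NormedAddCommGroup H] [InnerProductSpace ℂ H] [CompleteSpace H]
  {A₀ A : H →ₗ.[ℂ] H} {gp gm : H}

lemma sub_mem_neg_inverse_domain_iff (hle : A ≤ A₀†) (hker : LinearMap.ker A₀†.toFun = ⊥)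
    (hp : gp ∈ defectSpace A₀ I) (hm : gm ∈ defectSpace A₀ (-I)) :
    gp - gm ∈ (-A.inverse).domain ↔ gp + gm ∈ A.domain := by
  have h := sub_mem_graph_adjoint hp (neg_mem hm)
  rw [sub_neg_eq_add, ← sub_eq_add_neg] at h
  rw [← mem_inverse_domain_iff hle hker h]
  exact (Submodule.smul_mem_iff _ Complex.I_ne_zero).symm

lemma defectSpace_neg_inverse_of_ker_adjoint (hA₀ : IsSymmetricOp A₀)
    (hker : LinearMap.ker A₀†.toFun = ⊥) {z : ℂ} (hz : z ≠ 0) :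
    defectSpace (-A₀.inverse) z = defectSpace A₀ (-1 / z) :=
  defectSpace_neg_inverse hA₀.1 (ker_eq_bot_of_le (hA₀.2.le_adjoint hA₀.1) hker) hker hz

lemma isDeficiencyPair_neg_inverse_iff (hA₀ : IsSymmetricOp A₀) (hle : A ≤ A₀†)
    (hker : LinearMap.ker A₀†.toFun = ⊥) :
    IsDeficiencyPair (-A₀.inverse) (-A.inverse) gp gm ↔ IsDeficiencyPair A₀ A gp (-gm) := by
  have hplus : defectSpace (-A₀.inverse) I = defectSpace A₀ I := by
    rw [defectSpace_neg_inverse_of_ker_adjoint hA₀ hker Complex.I_ne_zero, neg_div, one_div,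
      Complex.inv_I, neg_neg]
  have hminus : defectSpace (-A₀.inverse) (-I) = defectSpace A₀ (-I) := by
    rw [defectSpace_neg_inverse_of_ker_adjoint hA₀ hker (neg_ne_zero.2 Complex.I_ne_zero),
      neg_div_neg_eq, one_div, Complex.inv_I]
  constructor
  · rintro ⟨hp, hm, hnp, hnm, hsub⟩
    rw [hplus] at hp
    rw [hminus] at hm
    refine ⟨hp, neg_mem hm, hnp, by rwa [norm_neg], ?_⟩
    rw [sub_neg_eq_add]
    exact (sub_mem_neg_inverse_domain_iff hle hker hp hm).1 hsub
  · rintro ⟨hp, hm, hnp, hnm, hsub⟩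
    rw [neg_mem_iff] at hm
    rw [norm_neg] at hnm
    rw [sub_neg_eq_add] at hsub
    exact ⟨hplus ▸ hp, hminus ▸ hm, hnp, hnm,
      (sub_mem_neg_inverse_domain_iff hle hker hp hm).2 hsub⟩

lemma exists_isDeficiencyPair_neg_inverse (hA₀ : IsSymmetricOp A₀) (hle : A ≤ A₀†)
    (hker : LinearMap.ker A₀†.toFun = ⊥) (h : ∃ gp gm, IsDeficiencyPair A₀ A gp gm) :
    ∃ gp gm, IsDeficiencyPair (-A₀.inverse) (-A.inverse) gp gm :=
  let ⟨gp, gm, h⟩ := h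
  ⟨gp, -gm, (isDeficiencyPair_neg_inverse_iff hA₀ hle hker).2 (by rwa [neg_neg])⟩

lemma neg_one_div_im_pos {z : ℂ} (hz : 0 < z.im) : 0 < (-1 / z).im := by
  rw [neg_div, one_div, Complex.neg_im, Complex.inv_im, neg_div, neg_neg]
  exact div_pos hz (Complex.normSq_pos.2 fun h => by simp [h] at hz)

lemma ne_zero_of_im_pos {z : ℂ} (hz : 0 < z.im) : z ≠ 0 := by
  rintro rfl
  exact hz.false

lemma neg_one_div_neg_one_div (z : ℂ) : -1 / (-1 / z) = z := by
  rw [div_div_eq_mul_div, neg_one_mul, neg_div_neg_eq, div_one]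

lemma neg_one_div_sub_I_div_add_I {z : ℂ} (hz : z ≠ 0) :
    (-1 / z - I) / (-1 / z + I) = -((z - I) / (z + I)) := by
  have hsub : -1 / z - I = -(I / z * (z - I)) := by
    field_simp
    linear_combination -Complex.I_sq
  have hadd : -1 / z + I = I / z * (z + I) := by
    field_simp
    linear_combination -Complex.I_sq
  rw [hsub, hadd, neg_div, mul_div_mul_left _ _ (div_ne_zero Complex.I_ne_zero hz)]

/- The factor `(z - i) / (z + i)` and the element `g₋` both change sign. -/
lemma IsLivsicFunction.neg_inverse {s : ℂ → ℂ} (hs : IsLivsicFunction A₀ A s)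
    (hA₀ : IsSymmetricOp A₀) (hle : A ≤ A₀†) (hker : LinearMap.ker A₀†.toFun = ⊥) :
    IsLivsicFunction (-A₀.inverse) (-A.inverse) fun z => s (-1 / z) where
  exists_pair := exists_isDeficiencyPair_neg_inverse hA₀ hle hker hs.exists_pair
  exists_defect z hz := by
    rw [defectSpace_neg_inverse_of_ker_adjoint hA₀ hker (ne_zero_of_im_pos hz)]
    exact hs.exists_defect _ (neg_one_div_im_pos hz)
  formula gp gm h z hz g hg hg0 := by
    rw [defectSpace_neg_inverse_of_ker_adjoint hA₀ hker (ne_zero_of_im_pos hz)] at hg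
    obtain ⟨hne, heq⟩ := hs.formula gp (-gm) ((isDeficiencyPair_neg_inverse_iff hA₀ hle hker).1 h)
      (-1 / z) (neg_one_div_im_pos hz) g hg hg0
    refine ⟨hne, ?_⟩
    rw [heq, neg_one_div_sub_I_div_add_I (ne_zero_of_im_pos hz), inner_neg_left, neg_div,
      neg_mul_neg]

/- If `y = -A⁻¹ f` and `y - z f = g`, then `z y` is the solution of `A a + z⁻¹ a = g`. -/
lemma IsWeylTitchmarshFunction.neg_inverse {M : ℂ → ℂ} (hM : IsWeylTitchmarshFunction A₀ A M)
    (hA₀ : IsSymmetricOp A₀) (hA : IsSelfAdjointExtension A₀ A)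
    (hker : LinearMap.ker A₀†.toFun = ⊥) :
    IsWeylTitchmarshFunction (-A₀.inverse) (-A.inverse) fun z => M (-1 / z) := by
  have hle := hA.le_adjoint hA₀.1
  have hkerA := ker_eq_bot_of_le hle hker
  refine ⟨exists_isDeficiencyPair_neg_inverse hA₀ hle hker hM.exists_pair,
    fun z hz => bijective_sub_smul ((isSelfAdjoint_neg_inverse_iff hkerA).2 hA.2) hz.ne',
    fun gp gm h z hz f hf => ?_⟩
  set y := (-A.inverse) f
  have hgraph : (z • y, -z • (f : H)) ∈ A.graph := by
    have h := A.graph.smul_mem (-z)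
      ((mem_graph_neg_inverse hkerA).1 ((-A.inverse).mem_graph f))
    rwa [Prod.smul_mk, neg_smul_neg] at h
  obtain ⟨a, ha, haf⟩ := (LinearPMap.mem_graph_iff _).1 hgraph
  have hcancel : -1 / z * z = -1 := div_mul_cancel₀ _ (ne_zero_of_im_pos hz)
  have hsolve : A a - (-1 / z) • (a : H) = gp := by
    rw [ha, haf, smul_smul, hcancel, ← hf]
    module
  rw [hM.formula gp (-gm) ((isDeficiencyPair_neg_inverse_iff hA₀ hle hker).1 h) _
    (neg_one_div_im_pos hz) a hsolve, ha, haf, smul_smul, mul_neg, hcancel, neg_neg, one_smul,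
    add_comm]

end Transfer

section NegInverse

variable {H : Type*} [NormedAddCommGroup H] [InnerProductSpace ℂ H] [CompleteSpace H]
  {𝔄 : OperatorTriple H} {κ : ℂ}

lemma OperatorTriple.IsRegular.negInverse (h𝔄 : 𝔄.IsRegular)
    (hker : LinearMap.ker 𝔄.symm†.toFun = ⊥) : 𝔄.negInverse.IsRegular := by
  have hd := h𝔄.symmetric.1
  have hkerSymm := ker_eq_bot_of_le (h𝔄.symmetric.2.le_adjoint hd) hker
  have hkerDiss := ker_eq_bot_of_le h𝔄.diss_le_adjoint hker
  have hkerRef := ker_eq_bot_of_le (h𝔄.selfAdjointExtension.le_adjoint hd) hker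
  have hsymm := h𝔄.symmetric.inverse hker
  exact {
    symmetric := hsymm.neg
    indices := (h𝔄.indices.inverse hd hkerSymm hker).neg hsymm.1
    le_diss := neg_mono (inverse_mono h𝔄.le_diss hkerDiss)
    maximalDissipative := h𝔄.maximalDissipative.neg_inverse (hd.mono h𝔄.le_diss.1) hkerDiss
    not_selfAdjoint := mt (isSelfAdjoint_neg_inverse_iff hkerDiss).1 h𝔄.not_selfAdjoint
    selfAdjointExtension := ⟨neg_mono (inverse_mono h𝔄.selfAdjointExtension.1 hkerRef),
      (isSelfAdjoint_neg_inverse_iff hkerRef).2 h𝔄.selfAdjointExtension.2⟩ }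

lemma OperatorTriple.IsVonNeumannParameter.negInverse (hκ : 𝔄.IsVonNeumannParameter κ)
    (h𝔄 : 𝔄.IsRegular) (hker : LinearMap.ker 𝔄.symm†.toFun = ⊥) :
    𝔄.negInverse.IsVonNeumannParameter κ where
  norm_lt_one := hκ.norm_lt_one
  exists_pair := exists_isDeficiencyPair_neg_inverse h𝔄.symmetric
    (h𝔄.selfAdjointExtension.le_adjoint h𝔄.symmetric.1) hker hκ.exists_pair
  mem_domain gp gm h := by
    have h' := (isDeficiencyPair_neg_inverse_iff h𝔄.symmetric
      (h𝔄.selfAdjointExtension.le_adjoint h𝔄.symmetric.1) hker).1 h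
    refine (sub_mem_neg_inverse_domain_iff h𝔄.diss_le_adjoint hker h'.mem_plus
      (Submodule.smul_mem _ κ (neg_mem_iff.1 h'.mem_minus))).2 ?_
    rw [← sub_neg_eq_add, ← smul_neg]
    exact hκ.mem_domain gp (-gm) h'

lemma OperatorTriple.IsCharacteristicFunction.negInverse {S : ℂ → ℂ}
    (hS : 𝔄.IsCharacteristicFunction S) (h𝔄 : 𝔄.IsRegular)
    (hker : LinearMap.ker 𝔄.symm†.toFun = ⊥) :
    𝔄.negInverse.IsCharacteristicFunction fun z => S (-1 / z) := by
  obtain ⟨s, k, hs, hk, h⟩ := hS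
  exact ⟨_, k, hs.neg_inverse h𝔄.symmetric (h𝔄.selfAdjointExtension.le_adjoint h𝔄.symmetric.1)
    hker, hk.negInverse h𝔄 hker, fun z hz => h _ (neg_one_div_im_pos hz)⟩

end NegInverse

section Shift

variable {H : Type*} [NormedAddCommGroup H] [InnerProductSpace ℂ H]

lemma inner_sub_conj_smul {a b u v : H} (h : ⟪b, u⟫_ℂ = ⟪a, v⟫_ℂ) (z : ℂ) :
    ⟪b - conj z • a, u⟫_ℂ = ⟪a, v - z • u⟫_ℂ := by
  rw [inner_sub_left, inner_sub_right, h, inner_smul_left, inner_smul_right, Complex.conj_conj]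

lemma inner_eq_inner_smul_iff {a b u : H} {z : ℂ} :
    ⟪b, u⟫_ℂ = ⟪a, z • u⟫_ℂ ↔ ⟪b - conj z • a, u⟫_ℂ = 0 := by
  rw [inner_sub_left, inner_smul_left, Complex.conj_conj, inner_smul_right, sub_eq_zero]

variable [CompleteSpace H] {A : H →ₗ.[ℂ] H} {z : ℂ}

lemma dense_domain_of_surjective_sub_smul (hA : A.IsFormalAdjoint A)
    (hz : Function.Surjective fun f : A.domain => A f - z • (f : H))
    (hz' : Function.Surjective fun f : A.domain => A f - conj z • (f : H)) :
    Dense (A.domain : Set H) := by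
  rw [Submodule.dense_iff_topologicalClosure_eq_top,
    Submodule.topologicalClosure_eq_top_iff, Submodule.eq_bot_iff]
  intro u hu
  obtain ⟨f, rfl⟩ := hz u
  obtain ⟨e, he : A e - conj z • (e : H) = f⟩ := hz' f
  have hinner : ⟪A e - conj z • (e : H), f⟫_ℂ = 0 :=
    (inner_sub_conj_smul (hA e f) z).trans (hu e e.2)
  rw [he, inner_self_eq_zero, Submodule.coe_eq_zero] at hinner
  simp only [hinner, LinearPMap.map_zero, Submodule.coe_zero, smul_zero, sub_zero]

lemma isSelfAdjoint_of_surjective_sub_smul (hA : A.IsFormalAdjoint A)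
    (hz : Function.Surjective fun f : A.domain => A f - z • (f : H))
    (hz' : Function.Surjective fun f : A.domain => A f - conj z • (f : H)) : IsSelfAdjoint A := by
  have hd := dense_domain_of_surjective_sub_smul hA hz hz'
  refine LinearPMap.isSelfAdjoint_def.2
    (le_antisymm (LinearPMap.le_of_le_graph ?_) (hA.le_adjoint hd))
  rintro ⟨x, y⟩ hxy
  obtain ⟨f, hf : A f - z • (f : H) = y - z • x⟩ := hz (y - z • x)
  obtain ⟨e, he : A e - conj z • (e : H) = x - f⟩ := hz' (x - f)
  have hx : ⟪A e - conj z • (e : H), x⟫_ℂ = ⟪(e : H), y - z • x⟫_ℂ :=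
    inner_sub_conj_smul ((mem_graph_adjoint hd).1 hxy _ _ (A.mem_graph e)) z
  have hfe : ⟪A e - conj z • (e : H), f⟫_ℂ = ⟪(e : H), y - z • x⟫_ℂ :=
    hf ▸ inner_sub_conj_smul (hA e f) z
  have hxf : x = f := by
    rw [← sub_eq_zero, ← inner_self_eq_zero (𝕜 := ℂ)]
    nth_rw 1 [← he]
    rw [inner_sub_right, hx, hfe, sub_self]
  subst hxf
  exact sub_left_inj.1 hf ▸ A.mem_graph f

end Shift

section Restriction

variable {H : Type*} [NormedAddCommGroup H] [InnerProductSpace ℂ H] {A₀ A : H →ₗ.[ℂ] H} {z : ℂ}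
  {g : H}

lemma rank_span_singleton (hg : g ≠ 0) : Module.rank ℂ (ℂ ∙ g) = 1 :=
  Module.rank_eq_one_iff_finrank_eq_one.2 (finrank_span_singleton hg)

lemma isClosed_restriction (hA : A.IsClosed)
    (hA₀ : ∀ a b, (a, b) ∈ A₀.graph ↔ (a, b) ∈ A.graph ∧ ⟪g, b - conj z • a⟫_ℂ = 0) :
    A₀.IsClosed := by
  have hgraph : (A₀.graph : Set (H × H)) =
      (A.graph : Set (H × H)) ∩ (fun p : H × H => ⟪g, p.2 - conj z • p.1⟫_ℂ) ⁻¹' {0} :=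
    Set.ext fun p => hA₀ p.1 p.2
  rw [LinearPMap.IsClosed, hgraph]
  exact IsClosed.inter hA (isClosed_singleton.preimage (by fun_prop))

variable [CompleteSpace H]

lemma exists_mem_graph_restriction_iff (hA : IsSelfAdjoint A) (hz : z.im ≠ 0)
    (hA₀ : ∀ a b, (a, b) ∈ A₀.graph ↔ (a, b) ∈ A.graph ∧ ⟪g, b - conj z • a⟫_ℂ = 0) {y : H} :
    (∃ a b, (a, b) ∈ A₀.graph ∧ b - conj z • a = y) ↔ y ∈ (ℂ ∙ g)ᗮ := by
  have hz' : (conj z).im ≠ 0 := by rwa [Complex.conj_im, neg_ne_zero]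
  rw [Submodule.mem_orthogonal_singleton_iff_inner_right]
  constructor
  · rintro ⟨a, b, hab, rfl⟩
    exact ((hA₀ a b).1 hab).2
  · intro hy
    obtain ⟨f, rfl⟩ := (bijective_sub_smul hA hz').2 y
    exact ⟨f, A f, (hA₀ _ _).2 ⟨A.mem_graph f, hy⟩, rfl⟩

lemma mem_span_singleton_iff_restriction (hA : IsSelfAdjoint A) (hz : z.im ≠ 0)
    (hA₀ : ∀ a b, (a, b) ∈ A₀.graph ↔ (a, b) ∈ A.graph ∧ ⟪g, b - conj z • a⟫_ℂ = 0) {u : H} :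
    u ∈ ℂ ∙ g ↔ ∀ a b, (a, b) ∈ A₀.graph → ⟪b - conj z • a, u⟫_ℂ = 0 := by
  rw [← (ℂ ∙ g).orthogonal_orthogonal, Submodule.mem_orthogonal]
  constructor
  · exact fun h a b hab => h _ ((exists_mem_graph_restriction_iff hA hz hA₀).1 ⟨a, b, hab, rfl⟩)
  · intro h y hy
    obtain ⟨a, b, hab, rfl⟩ := (exists_mem_graph_restriction_iff hA hz hA₀).2 hy
    exact h a b hab

lemma dense_domain_restriction (hA : IsSelfAdjoint A) (hz : z.im ≠ 0)
    (hA₀ : ∀ a b, (a, b) ∈ A₀.graph ↔ (a, b) ∈ A.graph ∧ ⟪g, b - conj z • a⟫_ℂ = 0)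
    (hg : g ∉ A.domain) : Dense (A₀.domain : Set H) := by
  rw [Submodule.dense_iff_topologicalClosure_eq_top,
    Submodule.topologicalClosure_eq_top_iff, Submodule.eq_bot_iff]
  intro u hu
  obtain ⟨f, rfl⟩ := (bijective_sub_smul hA hz).2 u
  have hf : (f : H) ∈ ℂ ∙ g := by
    refine (mem_span_singleton_iff_restriction hA hz hA₀).2 fun a b hab => ?_
    have hformal := isFormalAdjoint_iff.1 (isFormalAdjoint_of_isSelfAdjoint hA) _ _ _ _
      ((hA₀ a b).1 hab).1 (A.mem_graph f)
    exact (inner_sub_conj_smul hformal z).trans (hu a (LinearPMap.mem_domain_of_mem_graph hab))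
  obtain ⟨c, hc⟩ := Submodule.mem_span_singleton.1 hf
  have hc0 : c = 0 := by
    by_contra hc0
    exact hg ((Submodule.smul_mem_iff _ hc0).1 (hc ▸ f.2))
  have hf0 : f = 0 := Subtype.ext (by rw [← hc, hc0, zero_smul, Submodule.coe_zero])
  simp only [hf0, LinearPMap.map_zero, Submodule.coe_zero, smul_zero, sub_zero]

lemma defectSpace_restriction (hA : IsSelfAdjoint A) (hz : z.im ≠ 0)
    (hA₀ : ∀ a b, (a, b) ∈ A₀.graph ↔ (a, b) ∈ A.graph ∧ ⟪g, b - conj z • a⟫_ℂ = 0)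
    (hd : Dense (A₀.domain : Set H)) : defectSpace A₀ z = ℂ ∙ g := by
  ext u
  rw [mem_defectSpace, mem_graph_adjoint hd, mem_span_singleton_iff_restriction hA hz hA₀]
  simp only [inner_eq_inner_smul_iff]

end Restriction

section Kernel

variable {μ : Measure ℝ} {z : ℂ}

lemma ofReal_sub_ne_zero (hz : z.im ≠ 0) (t : ℝ) : (t : ℂ) - z ≠ 0 := by
  refine sub_ne_zero.2 ?_
  rintro rfl
  exact hz (Complex.ofReal_im t)

lemma norm_one_div_ofReal_sub_le (hz : z.im ≠ 0) (t : ℝ) : ‖1 / ((t : ℂ) - z)‖ ≤ 1 / |z.im| := by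
  have him : |z.im| ≤ ‖(t : ℂ) - z‖ := by
    simpa only [Complex.sub_im, Complex.ofReal_im, zero_sub, abs_neg] using
      Complex.abs_im_le_norm ((t : ℂ) - z)
  rw [norm_div, norm_one]
  exact one_div_le_one_div_of_le (abs_pos.2 hz) him

lemma sq_norm_ofReal_sub_I (t : ℝ) : ‖(t : ℂ) - I‖ ^ 2 = 1 + t ^ 2 := by
  rw [Complex.sq_norm, Complex.normSq_apply]
  simp only [Complex.sub_re, Complex.sub_im, Complex.ofReal_re, Complex.ofReal_im, Complex.I_re,
    Complex.I_im]
  ring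

lemma eLpNorm_two_one_div {α : Type*} [MeasurableSpace α] (ν : Measure α) (f : α → ℂ) :
    eLpNorm (fun t => 1 / f t) 2 ν =
      (∫⁻ t, ENNReal.ofReal (1 / ‖f t‖ ^ 2) ∂ν) ^ (1 / 2 : ℝ) := by
  rw [eLpNorm_eq_lintegral_rpow_enorm_toReal two_ne_zero ENNReal.ofNat_ne_top,
    ENNReal.toReal_ofNat]
  congr 2 with t
  rw [ENNReal.rpow_ofNat, ← ofReal_norm, ← ENNReal.ofReal_pow (norm_nonneg _), norm_div, norm_one,
    div_pow, one_pow]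

lemma eLpNorm_kernel_I (μ : Measure ℝ) : eLpNorm (fun t : ℝ => 1 / ((t : ℂ) - I)) 2 μ =
    (∫⁻ t, ENNReal.ofReal (1 / (1 + t ^ 2)) ∂μ) ^ (1 / 2 : ℝ) := by
  simp only [eLpNorm_two_one_div, sq_norm_ofReal_sub_I]

lemma aestronglyMeasurable_kernel (μ : Measure ℝ) (z : ℂ) :
    AEStronglyMeasurable (fun t : ℝ => 1 / ((t : ℂ) - z)) μ :=
  Measurable.aestronglyMeasurable (by fun_prop)

lemma memLp_kernel (hμ : ∫⁻ t, ENNReal.ofReal (1 / (1 + t ^ 2)) ∂μ ≠ ∞) (hz : z.im ≠ 0) :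
    MemLp (fun t : ℝ => 1 / ((t : ℂ) - z)) 2 μ := by
  have hI : MemLp (fun t : ℝ => 1 / ((t : ℂ) - I)) 2 μ := by
    refine ⟨aestronglyMeasurable_kernel μ I, ?_⟩
    rw [eLpNorm_kernel_I]
    exact ENNReal.rpow_lt_top_of_nonneg (by norm_num) hμ
  refine hI.of_le_mul (c := 1 + ‖z - I‖ * (1 / |z.im|)) (aestronglyMeasurable_kernel μ z)
    (Filter.Eventually.of_forall fun t => ?_)
  have hresolvent : 1 / ((t : ℂ) - z) =
      (1 + (z - I) * (1 / ((t : ℂ) - z))) * (1 / ((t : ℂ) - I)) := by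
    have hne := ofReal_sub_ne_zero hz t
    have hneI := ofReal_sub_ne_zero (z := I) (by simp) t
    field_simp
    ring
  calc ‖1 / ((t : ℂ) - z)‖
      = ‖1 + (z - I) * (1 / ((t : ℂ) - z))‖ * ‖1 / ((t : ℂ) - I)‖ := by
        rw [← norm_mul, ← hresolvent]
    _ ≤ (‖(1 : ℂ)‖ + ‖(z - I) * (1 / ((t : ℂ) - z))‖) * ‖1 / ((t : ℂ) - I)‖ := by
        gcongr
        exact norm_add_le _ _
    _ ≤ (1 + ‖z - I‖ * (1 / |z.im|)) * ‖1 / ((t : ℂ) - I)‖ := by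
        rw [norm_one, norm_mul]
        gcongr
        exact norm_one_div_ofReal_sub_le hz t

open Classical in
/-- The class of the Cauchy kernel `1 / (t - z)` in `L²(ℝ; dμ)`, which spans the deficiency space
of `symmOp μ` at `z`. It is `0` if the kernel is not square integrable. -/
noncomputable def kernelVec (μ : Measure ℝ) (z : ℂ) : Lp ℂ 2 μ :=
  if h : MemLp (fun t : ℝ => 1 / ((t : ℂ) - z)) 2 μ then h.toLp else 0

lemma coeFn_kernelVec (hμ : ∫⁻ t, ENNReal.ofReal (1 / (1 + t ^ 2)) ∂μ ≠ ∞) (hz : z.im ≠ 0) :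
    kernelVec μ z =ᵐ[μ] fun t : ℝ => 1 / ((t : ℂ) - z) := by
  rw [kernelVec, dif_pos (memLp_kernel hμ hz)]
  exact MemLp.coeFn_toLp _

lemma norm_kernelVec_I (hμ : ∫⁻ t, ENNReal.ofReal (1 / (1 + t ^ 2)) ∂μ = 1) :
    ‖kernelVec μ I‖ = 1 := by
  rw [Lp.norm_def, eLpNorm_congr_ae (coeFn_kernelVec (hμ ▸ ENNReal.one_ne_top) (by simp)),
    eLpNorm_kernel_I, hμ, ENNReal.one_rpow, ENNReal.toReal_one]

lemma norm_kernelVec_conj (hμ : ∫⁻ t, ENNReal.ofReal (1 / (1 + t ^ 2)) ∂μ ≠ ∞) (hz : z.im ≠ 0) :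
    ‖kernelVec μ (conj z)‖ = ‖kernelVec μ z‖ := by
  rw [Lp.norm_def, Lp.norm_def]
  congr 1
  refine eLpNorm_congr_norm_ae ?_
  filter_upwards [coeFn_kernelVec hμ hz, coeFn_kernelVec hμ (z := conj z)
    (by rwa [Complex.conj_im, neg_ne_zero])] with t ht ht'
  rw [ht, ht', ← RCLike.norm_conj, map_div₀, map_sub, Complex.conj_ofReal, Complex.conj_conj,
    map_one]

lemma norm_kernelVec_neg_I (hμ : ∫⁻ t, ENNReal.ofReal (1 / (1 + t ^ 2)) ∂μ ≠ ∞) :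
    ‖kernelVec μ (-I)‖ = ‖kernelVec μ I‖ := by
  rw [← Complex.conj_I]
  exact norm_kernelVec_conj hμ (by simp)

end Kernel

section MultiplicationOperator

variable {μ : Measure ℝ} {z w : ℂ}

lemma mem_graph_mulOp {f h : Lp ℂ 2 μ} :
    (f, h) ∈ (mulOp μ).graph ↔ ∀ᵐ t ∂μ, h t = (t : ℂ) * f t := by
  rw [LinearPMap.mem_graph_iff]
  constructor
  · rintro ⟨u, rfl, rfl⟩
    exact MemLp.coeFn_toLp u.2
  · intro hfh
    have hf : MemLp (fun t : ℝ => (t : ℂ) * f t) 2 μ := (memLp_congr_ae hfh).1 (Lp.memLp h)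
    exact ⟨⟨f, hf⟩, rfl, Lp.ext (hf.coeFn_toLp.trans (Filter.EventuallyEq.symm hfh))⟩

lemma coeFn_mulOp (f : (mulOp μ).domain) : ∀ᵐ t ∂μ, mulOp μ f t = (t : ℂ) * (f : Lp ℂ 2 μ) t :=
  mem_graph_mulOp.1 ((mulOp μ).mem_graph f)

lemma isFormalAdjoint_mulOp (μ : Measure ℝ) : (mulOp μ).IsFormalAdjoint (mulOp μ) := by
  intro f h
  rw [L2.inner_def, L2.inner_def]
  refine integral_congr_ae ?_
  filter_upwards [coeFn_mulOp f, coeFn_mulOp h] with t hf hh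
  simp only [hf, hh, RCLike.inner_apply, map_mul, Complex.conj_ofReal]
  ring

lemma surjective_mulOp_sub_smul (hz : z.im ≠ 0) :
    Function.Surjective fun f : (mulOp μ).domain => mulOp μ f - z • (f : Lp ℂ 2 μ) := by
  intro h
  have hmem : MemLp (fun t : ℝ => 1 / ((t : ℂ) - z) * h t) 2 μ := by
    refine (Lp.memLp h).of_le_mul (c := 1 / |z.im|)
      ((aestronglyMeasurable_kernel μ z).mul (Lp.aestronglyMeasurable h))
      (Filter.Eventually.of_forall fun t => ?_)
    rw [norm_mul]
    gcongr
    exact norm_one_div_ofReal_sub_le hz t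
  have hgraph : (hmem.toLp, h + z • hmem.toLp) ∈ (mulOp μ).graph := by
    rw [mem_graph_mulOp]
    filter_upwards [Lp.coeFn_add h (z • hmem.toLp), Lp.coeFn_smul z hmem.toLp, hmem.coeFn_toLp]
      with t hadd hsmul hquot
    have hne := ofReal_sub_ne_zero hz t
    rw [hadd, Pi.add_apply, hsmul, Pi.smul_apply, hquot, smul_eq_mul]
    field_simp
    ring
  obtain ⟨f, hf, hmul⟩ := (LinearPMap.mem_graph_iff _).1 hgraph
  exact ⟨f, sub_eq_iff_eq_add.2 (hmul.trans (by rw [hf]))⟩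

lemma isSelfAdjoint_mulOp (μ : Measure ℝ) : IsSelfAdjoint (mulOp μ) :=
  isSelfAdjoint_of_surjective_sub_smul (z := I) (isFormalAdjoint_mulOp μ)
    (surjective_mulOp_sub_smul (by simp)) (surjective_mulOp_sub_smul (by simp))

lemma kernelVec_sub_mem_domain (hμ : ∫⁻ t, ENNReal.ofReal (1 / (1 + t ^ 2)) ∂μ ≠ ∞)
    (hz : z.im ≠ 0) (hw : w.im ≠ 0) : kernelVec μ z - kernelVec μ w ∈ (mulOp μ).domain := by
  refine LinearPMap.mem_domain_of_mem_graph (y := z • kernelVec μ z - w • kernelVec μ w) ?_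
  rw [mem_graph_mulOp]
  filter_upwards [Lp.coeFn_sub (kernelVec μ z) (kernelVec μ w),
    Lp.coeFn_sub (z • kernelVec μ z) (w • kernelVec μ w), Lp.coeFn_smul z (kernelVec μ z),
    Lp.coeFn_smul w (kernelVec μ w), coeFn_kernelVec hμ hz, coeFn_kernelVec hμ hw]
    with t hsub hsub' hsmulz hsmulw hkerz hkerw
  have hnez := ofReal_sub_ne_zero hz t
  have hnew := ofReal_sub_ne_zero hw t
  rw [hsub, hsub', Pi.sub_apply, Pi.sub_apply, hsmulz, hsmulw, Pi.smul_apply, Pi.smul_apply,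
    hkerz, hkerw, smul_eq_mul, smul_eq_mul]
  field_simp
  ring

lemma kernelVec_notMem_domain (hinf : μ Set.univ = ∞)
    (hμ : ∫⁻ t, ENNReal.ofReal (1 / (1 + t ^ 2)) ∂μ ≠ ∞) (hz : z.im ≠ 0) :
    kernelVec μ z ∉ (mulOp μ).domain := by
  intro hmem
  have hmul : MemLp (fun t : ℝ => (t : ℂ) * kernelVec μ z t) 2 μ := hmem
  have hone : MemLp (fun _ : ℝ => (1 : ℂ)) 2 μ := by
    refine (memLp_congr_ae ?_).1 (hmul.sub ((Lp.memLp (kernelVec μ z)).const_smul z))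
    filter_upwards [coeFn_kernelVec hμ hz] with t ht
    have hne := ofReal_sub_ne_zero hz t
    rw [Pi.sub_apply, Pi.smul_apply, ht, smul_eq_mul]
    field_simp
  rw [memLp_const_iff two_ne_zero ENNReal.ofNat_ne_top, hinf] at hone
  exact hone.elim one_ne_zero (lt_irrefl _)

end MultiplicationOperator

section ModelOperators

variable {μ : Measure ℝ} {κ z : ℂ}

/- Since `(t - z̄) a(t)` paired with the kernel `1 / (t - z)` integrates to `∫ a dμ`, the condition
`∫ a dμ = 0` is orthogonality of `(mulOp μ - z̄) a` to `kernelVec μ z`. -/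
lemma mem_zeroMean_iff (hμ : ∫⁻ t, ENNReal.ofReal (1 / (1 + t ^ 2)) ∂μ ≠ ∞) (hz : z.im ≠ 0)
    {a b : Lp ℂ 2 μ} (hab : (a, b) ∈ (mulOp μ).graph) :
    a ∈ zeroMean μ ↔ ⟪kernelVec μ z, b - conj z • a⟫_ℂ = 0 := by
  have hinner : (fun t => ⟪kernelVec μ z t, (b - conj z • a : Lp ℂ 2 μ) t⟫_ℂ) =ᵐ[μ] a := by
    filter_upwards [coeFn_kernelVec hμ hz, mem_graph_mulOp.1 hab,
      Lp.coeFn_sub b (conj z • a), Lp.coeFn_smul (conj z) a] with t hker hmul hsub hsmul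
    have hne := ofReal_sub_ne_zero (z := conj z) (by rwa [Complex.conj_im, neg_ne_zero]) t
    rw [hker, hsub, Pi.sub_apply, hsmul, Pi.smul_apply, hmul, smul_eq_mul, RCLike.inner_apply,
      map_div₀, map_one, map_sub, Complex.conj_ofReal]
    field_simp
  have hint : Integrable a μ := (integrable_congr hinner).1 (L2.integrable_inner _ _)
  rw [L2.inner_def, integral_congr_ae hinner]
  exact ⟨fun h => h.2, fun h => ⟨hint, h⟩⟩

lemma mem_graph_symmOp (hμ : ∫⁻ t, ENNReal.ofReal (1 / (1 + t ^ 2)) ∂μ ≠ ∞) (hz : z.im ≠ 0)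
    (a b : Lp ℂ 2 μ) : (a, b) ∈ (symmOp μ).graph ↔
      (a, b) ∈ (mulOp μ).graph ∧ ⟪kernelVec μ z, b - conj z • a⟫_ℂ = 0 := by
  rw [symmOp, mem_graph_domRestrict, and_comm]
  exact and_congr_right (mem_zeroMean_iff hμ hz)

lemma isClosed_symmOp (hμ : ∫⁻ t, ENNReal.ofReal (1 / (1 + t ^ 2)) ∂μ ≠ ∞) :
    (symmOp μ).IsClosed :=
  isClosed_restriction (isSelfAdjoint_mulOp μ).isClosed (mem_graph_symmOp (z := I) hμ (by simp))

lemma isSelfAdjointExtension_mulOp (μ : Measure ℝ) :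
    IsSelfAdjointExtension (symmOp μ) (mulOp μ) :=
  ⟨LinearPMap.domRestrict_le, isSelfAdjoint_mulOp μ⟩

lemma isSymmetricOp_symmOp (hinf : μ Set.univ = ∞)
    (hμ : ∫⁻ t, ENNReal.ofReal (1 / (1 + t ^ 2)) ∂μ ≠ ∞) : IsSymmetricOp (symmOp μ) := by
  refine ⟨dense_domain_restriction (z := I) (isSelfAdjoint_mulOp μ) (by simp)
    (mem_graph_symmOp hμ (by simp)) (kernelVec_notMem_domain hinf hμ (by simp)), ?_⟩
  have hle := LinearPMap.le_graph_of_le (isSelfAdjointExtension_mulOp μ).1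
  exact isFormalAdjoint_iff.2 fun a b c d hab hcd =>
    isFormalAdjoint_iff.1 (isFormalAdjoint_mulOp μ) a b c d (hle hab) (hle hcd)

lemma defectSpace_symmOp (hinf : μ Set.univ = ∞)
    (hμ : ∫⁻ t, ENNReal.ofReal (1 / (1 + t ^ 2)) ∂μ ≠ ∞) (hz : z.im ≠ 0) :
    defectSpace (symmOp μ) z = ℂ ∙ kernelVec μ z :=
  defectSpace_restriction (isSelfAdjoint_mulOp μ) hz (mem_graph_symmOp hμ hz)
    (isSymmetricOp_symmOp hinf hμ).1

lemma kernelVec_mem_defectSpace (hinf : μ Set.univ = ∞)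
    (hμ : ∫⁻ t, ENNReal.ofReal (1 / (1 + t ^ 2)) ∂μ ≠ ∞) (hz : z.im ≠ 0) :
    kernelVec μ z ∈ defectSpace (symmOp μ) z :=
  defectSpace_symmOp hinf hμ hz ▸ Submodule.mem_span_singleton_self _

lemma kernelVec_ne_zero (hinf : μ Set.univ = ∞)
    (hμ : ∫⁻ t, ENNReal.ofReal (1 / (1 + t ^ 2)) ∂μ ≠ ∞) (hz : z.im ≠ 0) : kernelVec μ z ≠ 0 :=
  fun h => kernelVec_notMem_domain hinf hμ hz (h ▸ (mulOp μ).domain.zero_mem)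

lemma hasDeficiencyIndices_symmOp (hinf : μ Set.univ = ∞)
    (hμ : ∫⁻ t, ENNReal.ofReal (1 / (1 + t ^ 2)) ∂μ ≠ ∞) :
    HasDeficiencyIndices (symmOp μ) 1 1 := by
  have hrank : ∀ z : ℂ, z.im ≠ 0 → Module.rank ℂ (defectSpace (symmOp μ) z) = 1 := fun z hz => by
    rw [defectSpace_symmOp hinf hμ hz]
    exact rank_span_singleton (kernelVec_ne_zero hinf hμ hz)
  exact ⟨hrank _ (by simp), hrank _ (by simp)⟩

lemma isDeficiencyPair_kernelVec (hinf : μ Set.univ = ∞)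
    (hμ : ∫⁻ t, ENNReal.ofReal (1 / (1 + t ^ 2)) ∂μ = 1) :
    IsDeficiencyPair (symmOp μ) (mulOp μ) (kernelVec μ I) (kernelVec μ (-I)) := by
  have hfin : ∫⁻ t, ENNReal.ofReal (1 / (1 + t ^ 2)) ∂μ ≠ ∞ := hμ ▸ ENNReal.one_ne_top
  exact {
    mem_plus := kernelVec_mem_defectSpace hinf hfin (by simp)
    mem_minus := kernelVec_mem_defectSpace hinf hfin (by simp)
    norm_plus := norm_kernelVec_I hμ
    norm_minus := (norm_kernelVec_neg_I hfin).trans (norm_kernelVec_I hμ)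
    sub_mem := kernelVec_sub_mem_domain hfin (by simp) (by simp) }

lemma dissOp_eq_vonNeumannExtension (hμ : ∫⁻ t, ENNReal.ofReal (1 / (1 + t ^ 2)) ∂μ ≠ ∞)
    (κ : ℂ) :
    dissOp μ κ = vonNeumannExtension (symmOp μ) (kernelVec μ I) (κ • kernelVec μ (-I)) := by
  have hae : (kernelVec μ I - κ • kernelVec μ (-I) : Lp ℂ 2 μ) =ᵐ[μ]
      fun t : ℝ => 1 / ((t : ℂ) - I) - κ * (1 / ((t : ℂ) + I)) := by
    filter_upwards [Lp.coeFn_sub (kernelVec μ I) (κ • kernelVec μ (-I)),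
      Lp.coeFn_smul κ (kernelVec μ (-I)), coeFn_kernelVec hμ (z := I) (by simp),
      coeFn_kernelVec hμ (z := -I) (by simp)] with t hsub hsmul hplus hminus
    rw [hsub, Pi.sub_apply, hsmul, Pi.smul_apply, hplus, hminus, smul_eq_mul, sub_neg_eq_add]
  have hclass : {f : Lp ℂ 2 μ | (f : ℝ → ℂ) =ᵐ[μ]
      fun t => 1 / ((t : ℂ) - I) - κ * (1 / ((t : ℂ) + I))} =
      {kernelVec μ I - κ • kernelVec μ (-I)} :=
    Set.eq_singleton_iff_unique_mem.2 ⟨hae, fun f hf =>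
      Lp.ext (Filter.EventuallyEq.trans hf hae.symm)⟩
  rw [dissOp, extensionLine, hclass, vonNeumannExtension]

lemma smul_kernelVec_neg_I_mem_defectSpace (hinf : μ Set.univ = ∞)
    (hμ : ∫⁻ t, ENNReal.ofReal (1 / (1 + t ^ 2)) ∂μ ≠ ∞) (κ : ℂ) :
    κ • kernelVec μ (-I) ∈ defectSpace (symmOp μ) (-I) :=
  Submodule.smul_mem _ _ (kernelVec_mem_defectSpace hinf hμ (by simp))

lemma norm_smul_kernelVec_neg_I_lt (hinf : μ Set.univ = ∞)
    (hμ : ∫⁻ t, ENNReal.ofReal (1 / (1 + t ^ 2)) ∂μ ≠ ∞) (hκ : ‖κ‖ < 1) :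
    ‖κ • kernelVec μ (-I)‖ < ‖kernelVec μ I‖ := by
  rw [norm_smul, norm_kernelVec_neg_I hμ]
  exact mul_lt_of_lt_one_left (norm_pos_iff.2 (kernelVec_ne_zero hinf hμ (by simp))) hκ

lemma isQuasiSelfAdjointExtension_dissOp (hinf : μ Set.univ = ∞)
    (hμ : ∫⁻ t, ENNReal.ofReal (1 / (1 + t ^ 2)) ∂μ ≠ ∞) (hκ : ‖κ‖ < 1) :
    IsQuasiSelfAdjointExtension (symmOp μ) (dissOp μ κ) := by
  rw [dissOp_eq_vonNeumannExtension hμ]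
  exact isQuasiSelfAdjointExtension_vonNeumannExtension (isSymmetricOp_symmOp hinf hμ)
    (kernelVec_mem_defectSpace hinf hμ (by simp)) (smul_kernelVec_neg_I_mem_defectSpace hinf hμ κ)
    (norm_smul_kernelVec_neg_I_lt hinf hμ hκ)

lemma isRegular_modelTriple (hinf : μ Set.univ = ∞)
    (hμ : ∫⁻ t, ENNReal.ofReal (1 / (1 + t ^ 2)) ∂μ ≠ ∞) (hκ : ‖κ‖ < 1) :
    (modelTriple μ κ).IsRegular := by
  have hsymm := isSymmetricOp_symmOp hinf hμ
  have hplus := kernelVec_mem_defectSpace hinf hμ (z := I) (by simp)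
  have hminus := smul_kernelVec_neg_I_mem_defectSpace hinf hμ κ
  have hlt := norm_smul_kernelVec_neg_I_lt hinf hμ hκ
  have hdiss : (modelTriple μ κ).diss = _ := dissOp_eq_vonNeumannExtension hμ κ
  exact {
    symmetric := hsymm
    indices := hasDeficiencyIndices_symmOp hinf hμ
    le_diss := (isQuasiSelfAdjointExtension_dissOp hinf hμ hκ).1
    maximalDissipative := hdiss ▸ isMaximalDissipative_vonNeumannExtension hsymm
      (isClosed_symmOp hμ) (defectSpace_symmOp hinf hμ (by simp)) hminus hlt.le
    not_selfAdjoint := hdiss ▸ not_isSelfAdjoint_vonNeumannExtension hsymm hplus hminus hlt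
    selfAdjointExtension := isSelfAdjointExtension_mulOp μ }

lemma isVonNeumannParameter_modelTriple (hinf : μ Set.univ = ∞)
    (hμ : ∫⁻ t, ENNReal.ofReal (1 / (1 + t ^ 2)) ∂μ = 1) (hκ : ‖κ‖ < 1) :
    (modelTriple μ κ).IsVonNeumannParameter κ := by
  have hfin : ∫⁻ t, ENNReal.ofReal (1 / (1 + t ^ 2)) ∂μ ≠ ∞ := hμ ▸ ENNReal.one_ne_top
  have hpair := isDeficiencyPair_kernelVec hinf hμ
  have hdiss : (modelTriple μ κ).diss = _ := dissOp_eq_vonNeumannExtension hfin κ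
  exact (isRegular_modelTriple hinf hfin hκ).isVonNeumannParameter hpair hκ
    (hdiss ▸ sub_mem_vonNeumannExtension_domain hpair.mem_plus
      (Submodule.smul_mem _ κ hpair.mem_minus))

end ModelOperators

section CoreSpectrum

variable {μ : Measure ℝ}

lemma exists_ae_eq_of_mem_graph_adjoint_symmOp (hinf : μ Set.univ = ∞)
    (hμ : ∫⁻ t, ENNReal.ofReal (1 / (1 + t ^ 2)) ∂μ ≠ ∞) {u v : Lp ℂ 2 μ}
    (huv : (u, v) ∈ (symmOp μ)†.graph) : ∃ c : ℂ, ∀ᵐ t : ℝ ∂μ, v t = t * u t - c := by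
  obtain ⟨f, c, rfl, rfl⟩ := exists_add_smul_of_mem_graph_adjoint
    (isSelfAdjointExtension_mulOp μ) (isSymmetricOp_symmOp hinf hμ).1 (z := I) (by simp)
    (defectSpace_symmOp hinf hμ (by simp)) huv
  refine ⟨c, ?_⟩
  filter_upwards [Lp.coeFn_add (mulOp μ f) (c • I • kernelVec μ I),
    Lp.coeFn_smul c (I • kernelVec μ I), Lp.coeFn_smul I (kernelVec μ I),
    Lp.coeFn_add (f : Lp ℂ 2 μ) (c • kernelVec μ I), Lp.coeFn_smul c (kernelVec μ I),
    coeFn_kernelVec hμ (z := I) (by simp), coeFn_mulOp f]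
    with t haddv hsmulv hsmulI haddu hsmulu hker hmul
  have hne := ofReal_sub_ne_zero (z := I) (by simp) t
  rw [haddv, Pi.add_apply, hsmulv, Pi.smul_apply, hsmulI, Pi.smul_apply, haddu, Pi.add_apply,
    hsmulu, Pi.smul_apply, hker, hmul, smul_eq_mul, smul_eq_mul, smul_eq_mul]
  field_simp
  ring

lemma not_memLp_one_div_sub_of_mem_coreSpectrum {s : ℝ} (hs : s ∈ coreSpectrum μ) :
    ¬MemLp (fun t : ℝ => 1 / ((t : ℂ) - s)) 2 μ := by
  have hnorm : ∀ t : ℝ, ‖(t : ℂ) - s‖ ^ 2 = (t - s) ^ 2 := fun t => by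
    rw [← Complex.ofReal_sub, Complex.norm_real, Real.norm_eq_abs, sq_abs]
  intro hmem
  have htop := hmem.eLpNorm_ne_top
  simp only [eLpNorm_two_one_div, hnorm, hs.1] at htop
  exact htop (ENNReal.top_rpow_of_pos one_half_pos)

lemma eq_zero_of_ofReal_sub_mul_ae_eq_const {s : ℝ} (hs : s ∈ coreSpectrum μ) {u : Lp ℂ 2 μ}
    {c : ℂ} (hu : ∀ᵐ t : ℝ ∂μ, ((t : ℂ) - s) * u t = c) : u = 0 := by
  have hne : ∀ᵐ t : ℝ ∂μ, (t : ℂ) - s ≠ 0 := by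
    filter_upwards [measure_eq_zero_iff_ae_notMem.1 hs.2] with t ht
    exact sub_ne_zero.2 fun h => ht (Complex.ofReal_injective h)
  have hc : c = 0 := by
    by_contra hc
    refine not_memLp_one_div_sub_of_mem_coreSpectrum hs
      ((memLp_congr_ae ?_).1 ((Lp.memLp u).const_smul c⁻¹))
    filter_upwards [hu, hne] with t ht hts
    rw [Pi.smul_apply, smul_eq_mul, eq_div_iff hts, mul_assoc, mul_comm (u t), ht,
      inv_mul_cancel₀ hc]
  refine Lp.ext ?_
  filter_upwards [hu, hne, Lp.coeFn_zero ℂ 2 μ] with t ht hts hzero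
  rw [hzero, Pi.zero_apply]
  exact (mul_eq_zero.1 (ht.trans hc)).resolve_left hts

lemma defectSpace_symmOp_eq_bot (hinf : μ Set.univ = ∞)
    (hμ : ∫⁻ t, ENNReal.ofReal (1 / (1 + t ^ 2)) ∂μ ≠ ∞) {s : ℝ} (hs : s ∈ coreSpectrum μ) :
    defectSpace (symmOp μ) s = ⊥ := by
  refine (Submodule.eq_bot_iff _).2 fun u hu => ?_
  obtain ⟨c, hc⟩ := exists_ae_eq_of_mem_graph_adjoint_symmOp hinf hμ (mem_defectSpace.1 hu)
  refine eq_zero_of_ofReal_sub_mul_ae_eq_const hs (c := c) ?_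
  filter_upwards [hc, Lp.coeFn_smul (s : ℂ) u] with t ht hsmul
  rw [hsmul, Pi.smul_apply, smul_eq_mul] at ht
  linear_combination -ht

lemma ker_adjoint_symmOp (hinf : μ Set.univ = ∞)
    (hμ : ∫⁻ t, ENNReal.ofReal (1 / (1 + t ^ 2)) ∂μ ≠ ∞) (h0 : (0 : ℝ) ∈ coreSpectrum μ) :
    LinearMap.ker (symmOp μ)†.toFun = ⊥ := by
  refine ker_eq_bot_iff.2 fun u hu => ?_
  rw [← Submodule.mem_bot ℂ, ← defectSpace_symmOp_eq_bot hinf hμ h0, mem_defectSpace,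
    Complex.ofReal_zero, zero_smul]
  exact hu

end CoreSpectrum

end TripleModel

theorem mainTheorem2_general {H : Type*} [NormedAddCommGroup H] [InnerProductSpace ℂ H]
    [CompleteSpace H] {𝔄 : OperatorTriple H} {κ : ℂ} (h𝔄 : 𝔄.IsRegular)
    (hquasi : IsQuasiSelfAdjointExtension 𝔄.symm 𝔄.diss) (hκ : 𝔄.IsVonNeumannParameter κ)
    (hker : LinearMap.ker 𝔄.symm.adjoint.toFun = ⊥) :
    (LinearMap.ker 𝔄.symm.toFun = ⊥ ∧
      IsSymmetricOp 𝔄.symm.inverse ∧ HasDeficiencyIndices 𝔄.symm.inverse 1 1) ∧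
    (LinearMap.ker 𝔄.ref.toFun = ⊥ ∧
      IsSelfAdjointExtension 𝔄.symm.inverse 𝔄.ref.inverse) ∧
    (LinearMap.ker 𝔄.diss.toFun = ⊥ ∧
      IsQuasiSelfAdjointExtension 𝔄.symm.inverse 𝔄.diss.inverse) ∧
    𝔄.negInverse.IsRegular ∧
    ((∀ k, 𝔄.IsVonNeumannParameter k ↔ k = κ) ∧
      (∀ k, 𝔄.negInverse.IsVonNeumannParameter k ↔ k = κ)) ∧
    (∃ sB sC : ℂ → ℂ, IsLivsicFunction 𝔄.symm 𝔄.ref sB ∧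
      IsLivsicFunction (-𝔄.symm.inverse) (-𝔄.ref.inverse) sC ∧
      ∀ z : ℂ, 0 < z.im → sC (-1 / z) = sB z) ∧
    (∃ mB mC : ℂ → ℂ, IsWeylTitchmarshFunction 𝔄.symm 𝔄.ref mB ∧
      IsWeylTitchmarshFunction (-𝔄.symm.inverse) (-𝔄.ref.inverse) mC ∧
      ∀ z : ℂ, 0 < z.im → mC (-1 / z) = mB z) ∧
    (∃ SB SC : ℂ → ℂ, 𝔄.IsCharacteristicFunction SB ∧
      𝔄.negInverse.IsCharacteristicFunction SC ∧
      ∀ z : ℂ, 0 < z.im → SC (-1 / z) = SB z) := by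
  have hsymm := h𝔄.symmetric
  have hle := h𝔄.selfAdjointExtension.le_adjoint hsymm.1
  have hkerSymm := ker_eq_bot_of_le (hsymm.2.le_adjoint hsymm.1) hker
  have hkerRef := ker_eq_bot_of_le hle hker
  have h𝔄' := h𝔄.negInverse hker
  obtain ⟨s, hs⟩ := h𝔄.exists_isLivsicFunction hκ.exists_pair
  obtain ⟨M, hM⟩ := h𝔄.exists_isWeylTitchmarshFunction hκ.exists_pair
  obtain ⟨S, hS⟩ := h𝔄.exists_isCharacteristicFunction hκ
  have hcomp : ∀ (F : ℂ → ℂ) (z : ℂ), 0 < z.im → F (-1 / (-1 / z)) = F z :=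
    fun F z _ => congrArg F (neg_one_div_neg_one_div z)
  exact ⟨⟨hkerSymm, hsymm.inverse hker, h𝔄.indices.inverse hsymm.1 hkerSymm hker⟩,
    ⟨hkerRef, inverse_mono h𝔄.selfAdjointExtension.1 hkerRef,
      isSelfAdjoint_inverse h𝔄.selfAdjointExtension.2 hkerRef⟩,
    ⟨ker_eq_bot_of_le hquasi.2.1 hker, hquasi.inverse hsymm.1 hker⟩,
    h𝔄',
    ⟨hκ.iff_eq h𝔄, (hκ.negInverse h𝔄 hker).iff_eq h𝔄'⟩,
    ⟨s, _, hs, hs.neg_inverse hsymm hle hker, hcomp s⟩,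
    ⟨M, _, hM, hM.neg_inverse hsymm h𝔄.selfAdjointExtension hker, hcomp M⟩,
    ⟨S, _, hS, hS.negInverse h𝔄 hker, hcomp S⟩⟩

theorem mainTheorem2 (μ : Measure ℝ) (κ : ℂ)
    (hμ_infinite : μ Set.univ = ∞)
    (hμ_normalized : ∫⁻ t, ENNReal.ofReal (1 / (1 + t ^ 2)) ∂μ = 1)
    (hκ : ‖κ‖ < 1)
    (h0 : (0 : ℝ) ∈ coreSpectrum μ) :
    -- (i)
    (LinearMap.ker (symmOp μ).toFun = ⊥ ∧
      IsSymmetricOp (symmOp μ).inverse ∧ HasDeficiencyIndices (symmOp μ).inverse 1 1) ∧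
    -- (ii)
    (LinearMap.ker (mulOp μ).toFun = ⊥ ∧
      IsSelfAdjointExtension (symmOp μ).inverse (mulOp μ).inverse) ∧
    -- (iii)
    (LinearMap.ker (dissOp μ κ).toFun = ⊥ ∧
      IsQuasiSelfAdjointExtension (symmOp μ).inverse (dissOp μ κ).inverse) ∧
    (modelTriple μ κ).negInverse.IsRegular ∧
    -- (iv)
    ((∀ k, (modelTriple μ κ).IsVonNeumannParameter k ↔ k = κ) ∧
      (∀ k, (modelTriple μ κ).negInverse.IsVonNeumannParameter k ↔ k = κ)) ∧
    -- (v)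
    (∃ sB sC : ℂ → ℂ, IsLivsicFunction (symmOp μ) (mulOp μ) sB ∧
      IsLivsicFunction (-(symmOp μ).inverse) (-(mulOp μ).inverse) sC ∧
      ∀ z : ℂ, 0 < z.im → sC (-1 / z) = sB z) ∧
    -- (vi)
    (∃ mB mC : ℂ → ℂ, IsWeylTitchmarshFunction (symmOp μ) (mulOp μ) mB ∧
      IsWeylTitchmarshFunction (-(symmOp μ).inverse) (-(mulOp μ).inverse) mC ∧
      ∀ z : ℂ, 0 < z.im → mC (-1 / z) = mB z) ∧
    -- (vii)
    (∃ SB SC : ℂ → ℂ, (modelTriple μ κ).IsCharacteristicFunction SB ∧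
      (modelTriple μ κ).negInverse.IsCharacteristicFunction SC ∧
      ∀ z : ℂ, 0 < z.im → SC (-1 / z) = SB z) := by
  have hfin : ∫⁻ t, ENNReal.ofReal (1 / (1 + t ^ 2)) ∂μ ≠ ∞ :=
    hμ_normalized ▸ ENNReal.one_ne_top
  exact mainTheorem2_general (isRegular_modelTriple hμ_infinite hfin hκ)
    (isQuasiSelfAdjointExtension_dissOp hμ_infinite hfin hκ)
    (isVonNeumannParameter_modelTriple hμ_infinite hμ_normalized hκ)
    (ker_adjoint_symmOp hμ_infinite hfin h0)
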